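/- Let $n\ge 0$, let $\mathrm{Cl}(0,n)$ be the real Clifford algebra with generators $e_1,\dots,e_n$, $e_ie_j+e_je_i=-2\delta_{ij}$, and let $a\mapsto\bar a$ be Clifford conjugation (the anti-automorphism with $\bar e_j=-e_j$). Let $\varepsilon\in\{1,-1\}$. For $f:\mathbb R^{n+1}\to\mathrm{Cl}(0,n)$ put $$Df=\frac{\partial f}{\partial y_0}+\varepsilon\sum_{j=1}^n e_j\frac{\partial f}{\partial y_j},$$ and identify a point $x=(x_0,\dots,x_n)\in\mathbb R^{n+1}$ with $x_0+\varepsilon\sum_{j=1}^n x_je_j$ in Clifford products. Let $\Omega\subset\mathbb R^{n+1}$ be open. For $\lambda\in\mathrm{Cl}(0,n)$ let $\mathcal M_\lambda(\Omega)$ be the set of $f$ that are $C^1$ in $\Omega$, continuous on $\overline\Omega$, and satisfy $Df=f\lambda$ in $\Omega$. The Bergman space of $\Omega$ is the right $\mathrm{Cl}(0,n)$-module of $C^1$ solutions of $Df=0$ in $\Omega$ that are square integrable, with $\langle g,f\rangle=\int_\Omega\overline{g}\,f\,dy$; its Bergman kernel is the function $B$ on $\Omega\times\Omega$ such that, for every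 $x\in\Omega$, $y\mapsto\overline{B(x,y)}$ lies in the Bergman space and $\int_\Omega B(x,y)f(y)\,dy=f(x)$ for all $f$ in the Bergman space. Theorem (Bergman reproducing formula). (1) The Bergman kernel $B$ of $\Omega$ exists and is unique. (2) Let $\lambda\in\mathrm{Cl}(0,n)$ and $f\in\mathcal M_\lambda(\Omega)$, and suppose that $\Omega$ is bounded or that $y\mapsto f(y)e^{-y_0\lambda}$ is square integrable on $\Omega$. Then for every $x\in\Omega$ the following integral converges absolutely and $$\int_\Omega B(x,y)\,f(y)\,e^{(x_0-y_0)\lambda}\,dy=f(x).$$ (3) If, in the situation of (2), moreover $\lambda\in\mathbb R$, then, with $B'_\lambda(x,y)=B(x,y)e^{(x_0-y_0)\lambda}$, also $$\int_\Omega B'_\lambda(x,y)\,f(y)\,dy=f(x)\qquad(x\in\Omega),$$ again with an absolutely convergent integral. (4) If $\lambda\in\mathbb R$ and $\Omega$ is the unit ball $\{|x|<1\}$, then for all $x,y\in\Omega$, with $\rho=1-2\langle y,x\rangle+|y|^2|x|^2$, $$B'_\lambda(x,y)=\frac{\Gamma(\frac{n+1}{2})\,e^{(x_0-y_0)\lambda}}{2\pi^{(n+1)/2}}\left(\frac{n+1}{\rho^{(n+1)/2}}-\frac{2\bar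 x y}{\rho^{(n+1)/2}}+\frac{(n+1)\,\overline{(y-x|y|^2)}\,(x-y|x|^2)}{\rho^{(n+3)/2}}\right).$$ -/

import Mathlib

open MeasureTheory
open scoped ENNReal

namespace CliffordBergman

/-- Points of `ℝ^{n+1}`, with coordinates `y 0, y 1, …, y n` and the Euclidean norm. -/
abbrev Pt (n : ℕ) : Type := EuclideanSpace ℝ (Fin (n + 1))

/-- The negative definite quadratic form `v ↦ -(v₁² + ⋯ + vₙ²)` on `ℝⁿ`. -/
abbrev negSq (n : ℕ) : QuadraticForm ℝ (Fin n → ℝ) :=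
  QuadraticMap.weightedSumSquares ℝ (fun _ : Fin n => (-1 : ℝ))

/-- The real Clifford algebra `Cl(0,n)`. -/
abbrev Cl (n : ℕ) : Type := CliffordAlgebra (negSq n)

/-- The generators `e₁, …, eₙ` of `Cl(0,n)`. -/
noncomputable def gen {n : ℕ} (j : Fin n) : Cl n :=
  CliffordAlgebra.ι (negSq n) (Pi.single j 1)

theorem gen_mul_add_swap {n : ℕ} (i j : Fin n) :
    gen i * gen j + gen j * gen i = if i = j then -2 else 0 := by
  unfold gen
  rw [CliffordAlgebra.ι_mul_ι_add_swap]
  by_cases h : i = j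
  · subst h
    rw [if_pos rfl, QuadraticMap.polar_self]
    simp [QuadraticMap.weightedSumSquares_apply, Pi.single_apply]
    exact map_ofNat (algebraMap ℝ (Cl n)) 2
  · rw [if_neg h]
    have : QuadraticMap.polar (negSq n) (Pi.single i 1) (Pi.single j 1) = 0 := by
      simp only [QuadraticMap.polar, QuadraticMap.weightedSumSquares_apply, Pi.add_apply]
      rw [← Finset.sum_sub_distrib, ← Finset.sum_sub_distrib]
      refine Finset.sum_eq_zero fun k _ => ?_
      by_cases hk : k = i
      · subst hk
        simp [h]
      · simp [Pi.single_apply, hk]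
    rw [this, map_zero]

/-! ### Topology of the Clifford algebra

`Cl(0,n)` is finite dimensional, so it has a unique Hausdorff vector space topology, and all norms
on it are equivalent. We use the operator norm of left multiplication in a basis; continuity,
derivatives, exponentials, integrals and square integrability do not depend on this choice. -/

theorem exteriorAlgebra_finite (n : ℕ) : Module.Finite ℝ (ExteriorAlgebra ℝ (Fin n → ℝ)) := by
  rw [Module.finite_def]
  have htop := CliffordAlgebra.iSup_ι_range_eq_top (0 : QuadraticForm ℝ (Fin n → ℝ))
  have hle : (⊤ : Submodule ℝ (ExteriorAlgebra ℝ (Fin n → ℝ))) =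
      ⨆ i : Fin (n + 1), (⋀[ℝ]^(i : ℕ) (Fin n → ℝ)) := by
    refine le_antisymm ?_ le_top
    refine htop.symm.le.trans (iSup_le fun i => ?_)
    by_cases hi : i < n + 1
    · exact le_iSup (fun i : Fin (n + 1) => (⋀[ℝ]^(i : ℕ) (Fin n → ℝ))) ⟨i, hi⟩
    · have h0 : Module.finrank ℝ (⋀[ℝ]^i (Fin n → ℝ)) = 0 := by
        rw [exteriorPower.finrank_eq, Module.finrank_fin_fun]
        exact Nat.choose_eq_zero_of_lt (by omega)
      have hbot : (⋀[ℝ]^i (Fin n → ℝ)) = ⊥ := Submodule.finrank_eq_zero.mp h0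
      exact hbot.le.trans bot_le
  rw [hle]
  exact Submodule.fg_iSup _ fun i => Module.Finite.iff_fg.mp inferInstance

noncomputable instance instFiniteCl (n : ℕ) : Module.Finite ℝ (Cl n) :=
  haveI := exteriorAlgebra_finite n
  Module.Finite.equiv (CliffordAlgebra.equivExterior (negSq n)).symm

attribute [local instance] Matrix.linftyOpNormedRing Matrix.linftyOpNormedAlgebra in
noncomputable instance instNormedRingCl (n : ℕ) : NormedRing (Cl n) :=
  NormedRing.induced (Cl n) (Matrix _ _ ℝ) (Algebra.leftMulMatrix (Module.finBasis ℝ (Cl n)))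
    (Algebra.leftMulMatrix_injective _)

attribute [local instance] Matrix.linftyOpNormedRing Matrix.linftyOpNormedAlgebra in
noncomputable instance instNormedAlgebraCl (n : ℕ) : NormedAlgebra ℝ (Cl n) :=
  NormedAlgebra.induced ℝ (Cl n) (Matrix _ _ ℝ) (Algebra.leftMulMatrix (Module.finBasis ℝ (Cl n)))

instance instCompleteSpaceCl (n : ℕ) : CompleteSpace (Cl n) :=
  FiniteDimensional.complete ℝ (Cl n)

/-! ### Monogenic functions -/

/-- The paravector `x₀ + ε (x₁ e₁ + ⋯ + xₙ eₙ)` of a point `x`, for a sign `ε`. -/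
noncomputable def paravector {n : ℕ} (ε : ℝ) (x : Pt n) : Cl n :=
  algebraMap ℝ (Cl n) (x 0) + ε • ∑ j : Fin n, x j.succ • gen j

/-- The partial derivative `∂f/∂y_k` at `y`. -/
noncomputable def pderiv {n : ℕ} (k : Fin (n + 1)) (f : Pt n → Cl n) (y : Pt n) : Cl n :=
  fderiv ℝ f y (EuclideanSpace.single k 1)

/-- The generalized Cauchy-Riemann operator `D f = ∂f/∂y₀ + ε ∑ⱼ eⱼ ∂f/∂yⱼ`, acting from the left.
The sign `ε = -1` gives `∂f/∂y₀ - ∑ⱼ eⱼ ∂f/∂yⱼ`, and `ε = 1` gives `∂f/∂y₀ + ∑ⱼ eⱼ ∂f/∂yⱼ`. -/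
noncomputable def cauchyRiemann {n : ℕ} (ε : ℝ) (f : Pt n → Cl n) (y : Pt n) : Cl n :=
  pderiv 0 f y + ε • ∑ j : Fin n, gen j * pderiv j.succ f y

/-- The class `𝓜_λ(Ω)`: solutions in `Ω` of `D f = f λ` that are continuous on the closure
of `Ω`. -/
structure IsLambdaMonogenic {n : ℕ} (ε : ℝ) (lam : Cl n) (Ω : Set (Pt n))
    (f : Pt n → Cl n) : Prop where
  contDiffOn : ContDiffOn ℝ 1 f Ω
  equation : ∀ y ∈ Ω, cauchyRiemann ε f y = f y * lam
  continuousOn_closure : ContinuousOn f (closure Ω)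

/-- The Bergman space of `Ω`: the square integrable (left) monogenic functions in `Ω`. -/
structure MemBergmanSpace {n : ℕ} (ε : ℝ) (Ω : Set (Pt n)) (f : Pt n → Cl n) : Prop where
  contDiffOn : ContDiffOn ℝ 1 f Ω
  equation : ∀ y ∈ Ω, cauchyRiemann ε f y = 0
  memLp : MemLp f 2 (volume.restrict Ω)

/-- `B` is a reproducing kernel of the Bergman space, viewed as a right module over the Clifford
algebra with the inner product `⟨g, f⟩ = ∫_Ω conj(g) f`: for each `x ∈ Ω` the function
`y ↦ conj(B(x,y))` lies in the Bergman space, and its inner product with any `f` in the Bergman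
space is `f x`. Here `star` is the Clifford conjugation, with `star eⱼ = -eⱼ`. -/
structure IsBergmanKernel {n : ℕ} (ε : ℝ) (Ω : Set (Pt n)) (B : Pt n → Pt n → Cl n) : Prop where
  mem : ∀ x ∈ Ω, MemBergmanSpace ε Ω (fun y => star (B x y))
  reproducing : ∀ f, MemBergmanSpace ε Ω f → ∀ x ∈ Ω, ∫ y in Ω, B x y * f y = f x

open Classical in
/-- The Bergman kernel of `Ω` (that it exists and is unique on `Ω × Ω` has to be proved). -/
noncomputable def bergmanKernel {n : ℕ} (ε : ℝ) (Ω : Set (Pt n)) : Pt n → Pt n → Cl n :=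
  if h : ∃ B, IsBergmanKernel ε Ω B then h.choose else 0

/-- The kernel `B'_λ(x,y) = B(x,y) e^{(x₀-y₀)λ}`. -/
noncomputable def lambdaKernel {n : ℕ} (ε : ℝ) (Ω : Set (Pt n)) (lam : Cl n) (x y : Pt n) : Cl n :=
  bergmanKernel ε Ω x y * NormedSpace.exp ((x 0 - y 0) • lam)

/-- The explicit expression for `B'_λ(x,y)` on the unit ball, `λ` real, in terms of the
paravectors `X` of `x` and `Y` of `y` and of `ρ = 1 - 2⟨y,x⟩ + |y|²|x|²`. -/
noncomputable def ballKernel {n : ℕ} (ε : ℝ) (lam : ℝ) (x y : Pt n) : Cl n :=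
  let X := paravector ε x
  let Y := paravector ε y
  let ρ : ℝ := 1 - 2 * inner ℝ y x + ‖y‖ ^ 2 * ‖x‖ ^ 2
  let m : ℝ := (n : ℝ) + 1
  (Real.Gamma (m / 2) * Real.exp ((x 0 - y 0) * lam) / (2 * Real.pi ^ (m / 2))) •
    (algebraMap ℝ (Cl n) (m / ρ ^ (m / 2))
      - (2 / ρ ^ (m / 2)) • (star X * Y)
      + (m / ρ ^ ((m + 2) / 2)) • (star (Y - ‖y‖ ^ 2 • X) * (X - ‖x‖ ^ 2 • Y)))

end CliffordBergman

namespace CliffordBergman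

variable {n : ℕ}

/-! Right multiplication by `e^{-y₀λ}` turns `Df = fλ` into `Dg = 0`: `D` acts from the left and the
coefficient of `∂/∂y₀` is `1`, so the two terms `fλe^{-y₀λ}` cancel. The function `y ↦
f(y)e^{(x₀-y₀)λ}` is therefore in the Bergman space and takes the value `f(x)` at `y = x`; the
ordinary reproducing property gives the formula for every `λ`. For real `λ` the exponential is a
scalar and can be moved into the kernel.

Existence rests on a smooth mean value property. Smoothing the Cauchy kernel `conj z / |z|^{n+1}`
inside radius `t` and applying `D` from the right gives a scalar kernel `meanKernel t` that vanishes
for `|z| > t`; averaging a monogenic function against it gives `sphereArea n` times the value at the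
centre (`integral_meanKernel_smul`). Hence point evaluation is an `L²` pairing with a bump function,
and the Bergman space is closed in `L²` (`exists_memBergmanSpace_of_tendsto`). Projecting the bump
orthogonally onto it yields the kernel (`exists_dual_memBergmanSpace`). The projection needs a real
inner product for which multiplication by `star a` is adjoint to multiplication by `a`
(`exists_euclidean_equiv`); the right module structure then lifts the scalar identity to a
Clifford-valued one.

On the unit ball, `ρ = |y-x|²` and `y - |y|²x = y - x` when `|y| = 1`. So `ρ^{-(n+1)/2} conj(y -
|y|²x)` and the smoothed Cauchy kernel at `x` agree on the sphere. Their images under `D` from the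
right are `ballForm` and `meanKernel`. The divergence theorem for the difference shows that both
have the same integral against every Bergman function (`exists_ballPotential`,
`integral_ball_rightCauchyRiemann_mul_eq_zero`). As the conjugate of `ballForm` is itself monogenic
in `y`, uniqueness identifies the kernel. -/

theorem star_gen (j : Fin n) : star (gen j) = -gen j := by
  simp [gen]

theorem gen_mul_self (j : Fin n) : gen j * gen j = -1 := by
  have h := gen_mul_add_swap j j
  rw [if_pos rfl, ← two_mul] at h
  have h2 : (2 : ℝ) • (gen j * gen j) = (2 : ℝ) • (-1 : Cl n) := by
    simp only [two_smul, ← two_mul, h]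
    norm_num
  exact smul_right_injective (Cl n) (two_ne_zero : (2 : ℝ) ≠ 0) h2

theorem gen_mul_comm_of_ne {i j : Fin n} (h : i ≠ j) : gen i * gen j = -(gen j * gen i) := by
  have := gen_mul_add_swap i j
  rw [if_neg h] at this
  exact eq_neg_of_add_eq_zero_left this

/-- Clifford conjugation as a continuous linear map. -/
noncomputable def starL (n : ℕ) : Cl n →L[ℝ] Cl n :=
  LinearMap.toContinuousLinearMap
    { toFun := star
      map_add' := star_add
      map_smul' := fun r a => CliffordAlgebra.star_smul r a }

@[simp] theorem starL_apply (a : Cl n) : starL n a = star a := rfl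

theorem star_real_smul (r : ℝ) (a : Cl n) : star (r • a) = r • star a :=
  (starL n).map_smul r a

/-! ### A Euclidean structure compatible with Clifford conjugation -/

/-- Averaging, one generator at a time: replace `⟨a, b⟩` by `⟨a, b⟩ + ⟨eⱼa, eⱼb⟩`. Since `eⱼ² = -1`,
multiplication by `eⱼ` swaps the two summands; since `eᵢ` anticommutes with `eⱼ`, invariance under
earlier generators survives. -/
theorem exists_embedding_gen_isometric (s : Finset (Fin n)) :
    ∃ (ι : Type) (_ : Fintype ι) (T : Cl n →ₗ[ℝ] EuclideanSpace ℝ ι), Function.Injective T ∧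
      ∀ j ∈ s, ∀ a b, inner ℝ (T (gen j * a)) (T (gen j * b)) = inner ℝ (T a) (T b) := by
  induction s using Finset.induction_on with
  | empty =>
    exact ⟨_, inferInstance, (WithLp.linearEquiv 2 ℝ _).symm.toLinearMap.comp
      (Module.finBasis ℝ (Cl n)).equivFun.toLinearMap, fun a b h => by simpa using h, by simp⟩
  | insert j s hj ih =>
    obtain ⟨ι, _, T, hT, hs⟩ := ih
    let T' : Cl n →ₗ[ℝ] EuclideanSpace ℝ (ι ⊕ ι) :=
      { toFun := fun a => WithLp.toLp 2 (Sum.elim (T a) (T (gen j * a)))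
        map_add' := fun a b => by
          ext i
          cases i <;> simp [mul_add]
        map_smul' := fun r a => by
          ext i
          cases i <;> simp }
    have hin (a b : Cl n) : inner ℝ (T' a) (T' b) =
        inner ℝ (T a) (T b) + inner ℝ (T (gen j * a)) (T (gen j * b)) := by
      simp [T', PiLp.inner_apply, Fintype.sum_sum_type]
    have hjj (a : Cl n) : gen j * (gen j * a) = -a := by
      rw [← mul_assoc, gen_mul_self, neg_one_mul]
    refine ⟨ι ⊕ ι, inferInstance, T', fun a b h => hT ?_, fun i hi a b => ?_⟩
    · ext k
      have := congrArg (fun v => v (Sum.inl k)) h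
      simpa [T'] using this
    · rcases Finset.mem_insert.mp hi with rfl | hi
      · rw [hin, hin, hjj, hjj, map_neg, map_neg, inner_neg_neg, add_comm]
      · have hne : j ≠ i := fun h => hj (h ▸ hi)
        have hc (a : Cl n) : gen j * (gen i * a) = -(gen i * (gen j * a)) := by
          rw [← mul_assoc, gen_mul_comm_of_ne hne, neg_mul, mul_assoc]
        rw [hin, hin, hs i hi, hc, hc, map_neg, map_neg, inner_neg_neg, hs i hi]

theorem algebraMap_induction {P : Cl n → Prop} (hr : ∀ r, P (algebraMap ℝ _ r))
    (hg : ∀ j, P (gen j)) (hm : ∀ a b, P a → P b → P (a * b)) (ha : ∀ a b, P a → P b → P (a + b))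
    (a : Cl n) : P a := by
  induction a using CliffordAlgebra.induction with
  | algebraMap r => exact hr r
  | ι v =>
    have : CliffordAlgebra.ι (negSq n) v = ∑ j, algebraMap ℝ (Cl n) (v j) * gen j := by
      conv_lhs => rw [pi_eq_sum_univ' v]
      rw [map_sum]
      refine Finset.sum_congr rfl fun j _ => ?_
      rw [map_smul, gen, Algebra.smul_def]
    rw [this]
    refine Finset.sum_induction _ P ha (by simpa using hr 0) fun j _ => hm _ _ (hr _) (hg j)
  | mul a b h₁ h₂ => exact hm a b h₁ h₂
  | add a b h₁ h₂ => exact ha a b h₁ h₂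

/-- The Clifford algebra is isomorphic to a Euclidean space such that left multiplication by
`star a` is adjoint to left multiplication by `a`. -/
theorem exists_euclidean_equiv (n : ℕ) :
    ∃ (V : Type) (_ : NormedAddCommGroup V) (_ : InnerProductSpace ℝ V)
      (_ : FiniteDimensional ℝ V) (T : Cl n ≃L[ℝ] V),
      ∀ a b, inner ℝ (T a) (T b) = inner ℝ (T 1) (T (star a * b)) := by
  obtain ⟨ι, _, T, hT, h⟩ := exists_embedding_gen_isometric (Finset.univ : Finset (Fin n))
  -- An isometry with `eⱼ² = -1` has adjoint `-eⱼ = star eⱼ`; sums and products then follow because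
  -- `star` is an anti-automorphism.
  have hadj (a b c : Cl n) : inner ℝ (T (c * a)) (T b) = inner ℝ (T a) (T (star c * b)) := by
    induction c using algebraMap_induction generalizing a b with
    | hr r =>
      rw [CliffordAlgebra.star_algebraMap, ← Algebra.smul_def, ← Algebra.smul_def, map_smul,
        map_smul, inner_smul_left, inner_smul_right]
      rfl
    | hg j =>
      rw [← h j (Finset.mem_univ j) a, star_gen, neg_mul, mul_neg, ← mul_assoc, gen_mul_self]
      simp
    | hm c d hc hd => rw [mul_assoc, hc, hd, star_mul, mul_assoc]
    | ha c d hc hd =>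
      simp only [add_mul, map_add, inner_add_left, inner_add_right, star_add, hc, hd]
  refine ⟨LinearMap.range T, inferInstance, inferInstance, inferInstance,
    (LinearEquiv.ofInjective T hT).toContinuousLinearEquiv, fun a b => ?_⟩
  have := hadj 1 b a
  rwa [mul_one] at this

/-! ### The directions `1, ε e₁, …, ε eₙ` -/

/-- The paravectors `1, ε e₁, …, ε eₙ` of the standard basis of `ℝ^{n+1}`. -/
noncomputable def dir (ε : ℝ) (k : Fin (n + 1)) : Cl n :=
  Fin.cases 1 (fun j => ε • gen j) k

@[simp] theorem dir_zero (ε : ℝ) : dir ε (0 : Fin (n + 1)) = 1 := rfl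

@[simp] theorem dir_succ (ε : ℝ) (j : Fin n) : dir ε j.succ = ε • gen j := rfl

theorem paravector_eq_sum (ε : ℝ) (x : Pt n) : paravector ε x = ∑ k, x k • dir ε k := by
  rw [Fin.sum_univ_succ, paravector, dir_zero, Algebra.algebraMap_eq_smul_one, Finset.smul_sum]
  simp only [dir_succ, smul_comm ε]

theorem cauchyRiemann_eq_sum (ε : ℝ) (f : Pt n → Cl n) (y : Pt n) :
    cauchyRiemann ε f y = ∑ k, dir ε k * pderiv k f y := by
  rw [Fin.sum_univ_succ, cauchyRiemann, dir_zero, one_mul, Finset.smul_sum]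
  simp only [dir_succ, smul_mul_assoc]

theorem dir_mul_star_add {ε : ℝ} (hε : ε * ε = 1) (j k : Fin (n + 1)) :
    dir ε j * star (dir ε k) + dir ε k * star (dir ε j) = if j = k then 2 else 0 := by
  cases j using Fin.cases with
  | zero =>
    cases k using Fin.cases with
    | zero => norm_num
    | succ k => simp [star_gen, (Fin.succ_ne_zero k).symm]
  | succ j =>
    cases k using Fin.cases with
    | zero => simp [star_gen]
    | succ k =>
      have := gen_mul_add_swap j k
      simp only [dir_succ, star_real_smul, star_gen, smul_neg, mul_neg, smul_mul_smul_comm, hε,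
        one_smul, Fin.succ_inj]
      rw [← neg_add, this]
      split_ifs <;> simp

theorem star_dir_mul_add {ε : ℝ} (hε : ε * ε = 1) (j k : Fin (n + 1)) :
    star (dir ε j) * dir ε k + star (dir ε k) * dir ε j = if j = k then 2 else 0 := by
  cases j using Fin.cases with
  | zero =>
    cases k using Fin.cases with
    | zero => norm_num
    | succ k => simp [star_gen, (Fin.succ_ne_zero k).symm]
  | succ j =>
    cases k using Fin.cases with
    | zero => simp [star_gen]
    | succ k =>
      have := gen_mul_add_swap j k
      simp only [dir_succ, star_real_smul, star_gen, smul_neg, neg_mul, smul_mul_smul_comm, hε,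
        one_smul, Fin.succ_inj]
      rw [← neg_add, this]
      split_ifs <;> simp

/-- The embedding of `ℝ^{n+1}` as paravectors. -/
noncomputable def paravectorL (ε : ℝ) : Pt n →L[ℝ] Cl n :=
  ∑ k, (EuclideanSpace.proj k : Pt n →L[ℝ] ℝ).smulRight (dir ε k)

theorem paravectorL_apply (ε : ℝ) (x : Pt n) : paravectorL ε x = paravector ε x := by
  simp [paravectorL, paravector_eq_sum]

theorem paravector_single (ε : ℝ) (k : Fin (n + 1)) :
    paravector ε (EuclideanSpace.single k 1) = dir ε k := by
  simp [paravector_eq_sum, ite_smul]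

/-- Polarisation of `x x̄ = |x|²`. It exchanges the order of two paravector factors at the cost of a
scalar. -/
theorem paravector_mul_star_add {ε : ℝ} (hε : ε * ε = 1) (x y : Pt n) :
    paravector ε x * star (paravector ε y) + paravector ε y * star (paravector ε x) =
      (2 * inner ℝ x y) • 1 := by
  have h1 : paravector ε x * star (paravector ε y) =
      ∑ j, ∑ k, (x j * y k) • (dir ε j * star (dir ε k)) := by
    simp only [paravector_eq_sum, star_sum, star_real_smul, Finset.sum_mul_sum, smul_mul_smul_comm]
  have h2 : paravector ε y * star (paravector ε x) =
      ∑ j, ∑ k, (x j * y k) • (dir ε k * star (dir ε j)) := by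
    simp only [paravector_eq_sum, star_sum, star_real_smul, Finset.sum_mul_sum, smul_mul_smul_comm]
    rw [Finset.sum_comm]
    simp only [mul_comm]
  rw [h1, h2, ← Finset.sum_add_distrib]
  simp only [← Finset.sum_add_distrib, ← smul_add, dir_mul_star_add hε, smul_ite, smul_zero,
    Finset.sum_ite_eq, Finset.mem_univ, if_true]
  rw [← Finset.sum_smul, PiLp.inner_apply, mul_comm, mul_smul]
  simp [Algebra.smul_def, mul_comm, map_ofNat]

theorem star_paravector_mul_add {ε : ℝ} (hε : ε * ε = 1) (x y : Pt n) :
    star (paravector ε x) * paravector ε y + star (paravector ε y) * paravector ε x =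
      (2 * inner ℝ x y) • 1 := by
  have h1 : star (paravector ε x) * paravector ε y =
      ∑ j, ∑ k, (x j * y k) • (star (dir ε j) * dir ε k) := by
    simp only [paravector_eq_sum, star_sum, star_real_smul, Finset.sum_mul_sum, smul_mul_smul_comm]
  have h2 : star (paravector ε y) * paravector ε x =
      ∑ j, ∑ k, (x j * y k) • (star (dir ε k) * dir ε j) := by
    simp only [paravector_eq_sum, star_sum, star_real_smul, Finset.sum_mul_sum, smul_mul_smul_comm]
    rw [Finset.sum_comm]
    simp only [mul_comm]
  rw [h1, h2, ← Finset.sum_add_distrib]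
  simp only [← Finset.sum_add_distrib, ← smul_add, star_dir_mul_add hε, smul_ite, smul_zero,
    Finset.sum_ite_eq, Finset.mem_univ, if_true]
  rw [← Finset.sum_smul, PiLp.inner_apply, mul_comm, mul_smul]
  simp [Algebra.smul_def, mul_comm, map_ofNat]

theorem paravector_mul_star_self {ε : ℝ} (hε : ε * ε = 1) (x : Pt n) :
    paravector ε x * star (paravector ε x) = (‖x‖ ^ 2) • 1 := by
  have h := paravector_mul_star_add hε x x
  rw [← two_smul ℝ, mul_smul, real_inner_self_eq_norm_sq] at h
  exact smul_right_injective (Cl n) (two_ne_zero : (2 : ℝ) ≠ 0) h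

theorem star_paravector_mul_self {ε : ℝ} (hε : ε * ε = 1) (x : Pt n) :
    star (paravector ε x) * paravector ε x = (‖x‖ ^ 2) • 1 := by
  have h := star_paravector_mul_add hε x x
  rw [← two_smul ℝ, mul_smul, real_inner_self_eq_norm_sq] at h
  exact smul_right_injective (Cl n) (two_ne_zero : (2 : ℝ) ≠ 0) h

theorem sum_star_dir_mul_dir {ε : ℝ} (hε : ε * ε = 1) :
    ∑ k, star (dir ε k) * dir ε k = ((n : ℝ) + 1) • (1 : Cl n) := by
  have h (k : Fin (n + 1)) : star (dir ε k) * dir ε k = 1 := by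
    have := star_paravector_mul_self hε (EuclideanSpace.single k (1 : ℝ))
    rwa [paravector_single, PiLp.norm_single, norm_one, one_pow, one_smul] at this
  simp only [h, Finset.sum_const, Finset.card_univ, Fintype.card_fin, nsmul_eq_mul]
  simp [Algebra.smul_def]

theorem sum_dir_mul_star_dir {ε : ℝ} (hε : ε * ε = 1) :
    ∑ k, dir ε k * star (dir ε k) = ((n : ℝ) + 1) • (1 : Cl n) := by
  have h (k : Fin (n + 1)) : dir ε k * star (dir ε k) = 1 := by
    have := paravector_mul_star_self hε (EuclideanSpace.single k (1 : ℝ))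
    rwa [paravector_single, PiLp.norm_single, norm_one, one_pow, one_smul] at this
  simp only [h, Finset.sum_const, Finset.card_univ, Fintype.card_fin, nsmul_eq_mul]
  simp [Algebra.smul_def]

/-! ### The divergence theorem for compactly supported test functions -/

/-- The Cauchy-Riemann operator acting from the right. -/
noncomputable def rightCauchyRiemann (ε : ℝ) (W : Pt n → Cl n) (y : Pt n) : Cl n :=
  ∑ k, pderiv k W y * dir ε k

theorem integral_fderiv_apply_eq_zero {g : Pt n → Cl n} (hg : ContDiff ℝ 1 g)
    (hc : HasCompactSupport g) (v : Pt n) : ∫ y, fderiv ℝ g y v = 0 := by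
  have h := integral_smul_fderiv_eq_neg_fderiv_smul_of_integrable (μ := volume)
    (f := fun _ : Pt n => (1 : ℝ)) (g := g) (v := v) (by simp)
    (by
      simp only [one_smul]
      exact ((hg.continuous_fderiv one_ne_zero).clm_apply
        continuous_const).integrable_of_hasCompactSupport (hc.fderiv_apply ℝ v))
    (by
      simp only [one_smul]
      exact hg.continuous.integrable_of_hasCompactSupport hc)
    (fun _ _ => differentiableAt_const _)
    (fun _ _ => hg.differentiable one_ne_zero _)
  simpa using h

theorem contDiff_mul_of_tsupport_subset {Ω : Set (Pt n)} (hΩ : IsOpen Ω) {W f : Pt n → Cl n}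
    (hW : ContDiff ℝ 1 W) (hs : tsupport W ⊆ Ω) (hf : ContDiffOn ℝ 1 f Ω) :
    ContDiff ℝ 1 (fun y => W y * f y) := by
  rw [contDiff_iff_contDiffAt]
  intro y
  by_cases hy : y ∈ Ω
  · exact hW.contDiffAt.mul (hf.contDiffAt (hΩ.mem_nhds hy))
  · have h0 := notMem_tsupport_iff_eventuallyEq.mp (fun h => hy (hs h))
    refine (contDiffAt_const (c := (0 : Cl n))).congr_of_eventuallyEq ?_
    filter_upwards [h0] with z hz
    simp [hz]

theorem pderiv_mul {k : Fin (n + 1)} {f g : Pt n → Cl n} {y : Pt n} (hf : DifferentiableAt ℝ f y)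
    (hg : DifferentiableAt ℝ g y) :
    pderiv k (fun y => f y * g y) y = f y * pderiv k g y + pderiv k f y * g y := by
  simp [pderiv, fderiv_fun_mul' hf hg]

theorem pderiv_const_mul {k : Fin (n + 1)} (a : Cl n) {g : Pt n → Cl n} {y : Pt n}
    (hg : DifferentiableAt ℝ g y) : pderiv k (fun y => a * g y) y = a * pderiv k g y := by
  rw [pderiv_mul (differentiableAt_const a) hg]
  simp [pderiv]

theorem pderiv_mul_const {k : Fin (n + 1)} (a : Cl n) {g : Pt n → Cl n} {y : Pt n}
    (hg : DifferentiableAt ℝ g y) : pderiv k (fun y => g y * a) y = pderiv k g y * a := by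
  rw [pderiv_mul hg (differentiableAt_const a)]
  simp [pderiv]

/-- Since `∑ₖ ∂ₖ(W dₖ f) = (WD)f + W(Df)`, where `dₖ` is `dir ε k` and `WD` is the operator acting
from the right, the integrand is a sum of derivatives of compactly supported functions when `Df =
0`. The support of `W` makes these functions `C¹` on the whole space although `f` is controlled only
in `Ω`. -/
theorem integral_rightCauchyRiemann_mul_eq_zero {ε : ℝ} {Ω : Set (Pt n)} (hΩ : IsOpen Ω)
    {W f : Pt n → Cl n} (hW : ContDiff ℝ 1 W) (hc : HasCompactSupport W) (hs : tsupport W ⊆ Ω)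
    (hf : ContDiffOn ℝ 1 f Ω) (hDf : ∀ y ∈ Ω, cauchyRiemann ε f y = 0) :
    ∫ y, rightCauchyRiemann ε W y * f y = 0 := by
  have hg (k : Fin (n + 1)) : ContDiff ℝ 1 (fun y => W y * (dir ε k * f y)) :=
    contDiff_mul_of_tsupport_subset hΩ hW hs (contDiffOn_const.mul hf)
  have hgc (k : Fin (n + 1)) : HasCompactSupport (fun y => W y * (dir ε k * f y)) := hc.mul_right
  have hsum (y : Pt n) : rightCauchyRiemann ε W y * f y =
      ∑ k, pderiv k (fun y => W y * (dir ε k * f y)) y := by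
    by_cases hy : y ∈ Ω
    · have hd : DifferentiableAt ℝ f y :=
        (hf.contDiffAt (hΩ.mem_nhds hy)).differentiableAt one_ne_zero
      have hWd := hW.differentiable one_ne_zero y
      simp only [pderiv_mul hWd (hd.const_mul _), pderiv_const_mul _ hd, Finset.sum_add_distrib]
      rw [← Finset.mul_sum, ← cauchyRiemann_eq_sum, hDf y hy, mul_zero, zero_add,
        rightCauchyRiemann, Finset.sum_mul]
      simp only [mul_assoc]
    · have h0 := notMem_tsupport_iff_eventuallyEq.mp (fun h => hy (hs h))
      have h1 : fderiv ℝ W y = 0 := by rw [h0.fderiv_eq]; simp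
      have h2 (k : Fin (n + 1)) : fderiv ℝ (fun y => W y * (dir ε k * f y)) y = 0 := by
        have : (fun y => W y * (dir ε k * f y)) =ᶠ[nhds y] fun _ => 0 := by
          filter_upwards [h0] with z hz
          simp [hz]
        rw [this.fderiv_eq]; simp
      simp [rightCauchyRiemann, pderiv, h1, h2]
  simp only [hsum]
  rw [integral_finsetSum]
  · exact Finset.sum_eq_zero fun k _ => integral_fderiv_apply_eq_zero (hg k) (hgc k) _
  · intro k _
    exact (((hg k).continuous_fderiv one_ne_zero).clm_apply
      continuous_const).integrable_of_hasCompactSupport ((hgc k).fderiv_apply ℝ _)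

/-! ### Product rules -/

theorem sum_smul_dir_of_hasFDerivAt (ε : ℝ) (w : Pt n) :
    ∑ k, (innerSL ℝ w) (EuclideanSpace.single k (1 : ℝ)) • dir ε k = paravector ε w := by
  rw [paravector_eq_sum]
  refine Finset.sum_congr rfl fun k _ => ?_
  simp [EuclideanSpace.inner_single_right]

/-- Writing the derivative of the scalar factor as `innerSL ℝ w` exposes its gradient `w`, which
enters as a paravector on the side from which the operator acts. -/
theorem rightCauchyRiemann_smul (ε : ℝ) {u : Pt n → ℝ} {w y : Pt n} {F : Pt n → Cl n}
    (hu : HasFDerivAt u (innerSL ℝ w) y) (hF : DifferentiableAt ℝ F y) :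
    rightCauchyRiemann ε (fun y => u y • F y) y =
      u y • rightCauchyRiemann ε F y + F y * paravector ε w := by
  rw [← sum_smul_dir_of_hasFDerivAt, Finset.mul_sum, rightCauchyRiemann, rightCauchyRiemann,
    Finset.smul_sum, ← Finset.sum_add_distrib]
  refine Finset.sum_congr rfl fun k _ => ?_
  rw [pderiv, (hu.fun_smul hF.hasFDerivAt).fderiv]
  simp [pderiv, add_mul]

theorem cauchyRiemann_smul (ε : ℝ) {u : Pt n → ℝ} {w y : Pt n} {F : Pt n → Cl n}
    (hu : HasFDerivAt u (innerSL ℝ w) y) (hF : DifferentiableAt ℝ F y) :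
    cauchyRiemann ε (fun y => u y • F y) y =
      u y • cauchyRiemann ε F y + paravector ε w * F y := by
  rw [← sum_smul_dir_of_hasFDerivAt, Finset.sum_mul, cauchyRiemann_eq_sum, cauchyRiemann_eq_sum,
    Finset.smul_sum, ← Finset.sum_add_distrib]
  refine Finset.sum_congr rfl fun k _ => ?_
  rw [pderiv, (hu.fun_smul hF.hasFDerivAt).fderiv]
  simp [pderiv, mul_add]

theorem contDiff_paravector {ε : ℝ} {m : WithTop ℕ∞} : ContDiff ℝ m (paravector (n := n) ε) := by
  have : paravector (n := n) ε = paravectorL ε := funext fun x => (paravectorL_apply ε x).symm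
  rw [this]
  exact ContinuousLinearMap.contDiff _

theorem contDiff_star {m : WithTop ℕ∞} : ContDiff ℝ m (star : Cl n → Cl n) :=
  (starL n).contDiff

theorem hasFDerivAt_paravector (ε : ℝ) (y : Pt n) :
    HasFDerivAt (paravector ε) (paravectorL (n := n) ε) y := by
  have : paravector (n := n) ε = paravectorL ε := funext fun x => (paravectorL_apply ε x).symm
  rw [this]
  exact ContinuousLinearMap.hasFDerivAt _

theorem hasFDerivAt_star_paravector (ε : ℝ) (y : Pt n) :
    HasFDerivAt (fun y => star (paravector ε y)) ((starL n).comp (paravectorL (n := n) ε)) y :=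
  (starL n).hasFDerivAt.comp y (hasFDerivAt_paravector ε y)

theorem paravector_sub (ε : ℝ) (x y : Pt n) :
    paravector ε (x - y) = paravector ε x - paravector ε y := by
  simp only [← paravectorL_apply, map_sub]

theorem paravector_smul (ε r : ℝ) (x : Pt n) : paravector ε (r • x) = r • paravector ε x := by
  simp only [← paravectorL_apply, map_smul]

theorem hasFDerivAt_norm_sub_sq (x y : Pt n) :
    HasFDerivAt (fun y => ‖y - x‖ ^ 2) (innerSL ℝ ((2 : ℝ) • (y - x))) y := by
  refine ((hasFDerivAt_id y).sub_const x).norm_sq.congr_fderiv ?_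
  ext v
  simp

theorem hasFDerivAt_norm_sq (y : Pt n) :
    HasFDerivAt (fun y : Pt n => ‖y‖ ^ 2) (innerSL ℝ ((2 : ℝ) • y)) y := by
  simpa using hasFDerivAt_norm_sub_sq 0 y

theorem hasFDerivAt_comp_innerSL {P : ℝ → ℝ} {P' : ℝ} {u : Pt n → ℝ} {w y : Pt n}
    (hP : HasDerivAt P P' (u y)) (hu : HasFDerivAt u (innerSL ℝ w) y) :
    HasFDerivAt (fun y => P (u y)) (innerSL ℝ (P' • w)) y := by
  refine (hP.comp_hasFDerivAt y hu).congr_fderiv ?_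
  ext v
  simp

/-- The radial vector fields `P(|y-x|²) conj(y-x)`. -/
theorem rightCauchyRiemann_radial {ε : ℝ} (hε : ε * ε = 1) {P : ℝ → ℝ} (x y : Pt n)
    (hP : DifferentiableAt ℝ P (‖y - x‖ ^ 2)) :
    rightCauchyRiemann ε (fun y => P (‖y - x‖ ^ 2) • star (paravector ε (y - x))) y =
      (((n : ℝ) + 1) * P (‖y - x‖ ^ 2) + 2 * ‖y - x‖ ^ 2 * deriv P (‖y - x‖ ^ 2)) • 1 := by
  have hF : HasFDerivAt (fun y => star (paravector ε (y - x)))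
      ((starL n).comp (paravectorL (n := n) ε)) y :=
    
    (HasFDerivAt.comp (g := fun z => star (paravector ε z)) y
      (hasFDerivAt_star_paravector ε (y - x)) ((hasFDerivAt_id y).sub_const x)).congr_fderiv
        (ContinuousLinearMap.comp_id _)
  rw [rightCauchyRiemann_smul ε
    (hasFDerivAt_comp_innerSL hP.hasDerivAt (hasFDerivAt_norm_sub_sq x y))
    hF.differentiableAt, rightCauchyRiemann]
  simp only [pderiv, hF.fderiv, ContinuousLinearMap.comp_apply, paravectorL_apply,
    paravector_single, starL_apply, sum_star_dir_mul_dir hε, paravector_smul, mul_smul_comm,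
    star_paravector_mul_self hε, smul_smul, ← add_smul]
  congr 1
  ring

open Filter Topology Metric
open scoped ContDiff Convolution

/-! ### Smoothed powers and radial averaging kernels -/

/-- A smooth function on `ℝ` that agrees with `s ^ (-m/2)` for `1 ≤ s`. -/
noncomputable def cutPow (m s : ℝ) : ℝ := Real.smoothTransition (2 * s - 1) * s ^ (-(m / 2))

theorem cutPow_of_one_le {m s : ℝ} (hs : 1 ≤ s) : cutPow m s = s ^ (-(m / 2)) := by
  rw [cutPow, Real.smoothTransition.one_of_one_le (by linarith), one_mul]

theorem contDiff_cutPow (m : ℝ) : ContDiff ℝ ∞ (cutPow m) := by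
  rw [contDiff_iff_contDiffAt]
  intro s
  by_cases hs : 0 < s
  · refine ContDiffAt.mul ?_ (Real.contDiffAt_rpow_const_of_ne hs.ne')
    exact (Real.smoothTransition.contDiff.comp
      ((contDiff_const.mul contDiff_id).sub contDiff_const)).contDiffAt
  · refine (contDiffAt_const (c := (0 : ℝ))).congr_of_eventuallyEq ?_
    filter_upwards [Iio_mem_nhds (show s < 1 / 2 by linarith)] with r hr
    rw [Set.mem_Iio] at hr
    rw [cutPow, Real.smoothTransition.zero_of_nonpos (by linarith), zero_mul]

/-- A smooth function on `ℝ` that agrees with `s ^ (-m/2)` for `t² ≤ s`. -/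
noncomputable def smoothPow (m t s : ℝ) : ℝ := (t ^ 2) ^ (-(m / 2)) * cutPow m (s / t ^ 2)

theorem smoothPow_of_le {m t s : ℝ} (ht : 0 < t) (hs : t ^ 2 ≤ s) :
    smoothPow m t s = s ^ (-(m / 2)) := by
  have ht2 : 0 < t ^ 2 := by positivity
  rw [smoothPow, cutPow_of_one_le ((one_le_div ht2).mpr hs), ← Real.mul_rpow ht2.le
    (div_nonneg (ht2.le.trans hs) ht2.le), mul_div_cancel₀ _ ht2.ne']

theorem contDiff_smoothPow (m t : ℝ) : ContDiff ℝ ∞ (smoothPow m t) :=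
  contDiff_const.mul ((contDiff_cutPow m).comp (contDiff_id.div_const _))

theorem differentiable_smoothPow (m t : ℝ) : Differentiable ℝ (smoothPow m t) :=
  (contDiff_smoothPow m t).differentiable (by simp)

theorem deriv_smoothPow_of_lt {m t s : ℝ} (ht : 0 < t) (hs : t ^ 2 < s) :
    deriv (smoothPow m t) s = -(m / 2) * s ^ (-(m / 2) - 1) := by
  have h : smoothPow m t =ᶠ[𝓝 s] fun s => s ^ (-(m / 2)) := by
    filter_upwards [Ioi_mem_nhds hs] with r hr
    exact smoothPow_of_le ht (le_of_lt hr)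
  rw [h.deriv_eq]
  exact (Real.hasDerivAt_rpow_const (Or.inl ((pow_pos ht 2).trans hs).ne')).deriv

theorem deriv_smoothPow (m t s : ℝ) :
    deriv (smoothPow m t) s = (t ^ 2) ^ (-(m / 2)) * (deriv (cutPow m) (s / t ^ 2) / t ^ 2) := by
  have h : HasDerivAt (smoothPow m t)
      ((t ^ 2) ^ (-(m / 2)) * (deriv (cutPow m) (s / t ^ 2) * (1 / t ^ 2))) s := by
    exact HasDerivAt.const_mul _ (HasDerivAt.comp (h₂ := cutPow m) s
      (((contDiff_cutPow m).differentiable (by simp)) _).hasDerivAt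
      ((hasDerivAt_id s).div_const _))
  rw [h.deriv, mul_one_div]

theorem contDiff_deriv_smoothPow (m t : ℝ) : ContDiff ℝ ∞ (deriv (smoothPow m t)) :=
  ((contDiff_infty_iff_deriv.mp (contDiff_smoothPow m t))).2

/-- A smooth radial kernel supported in the ball of radius `t`, such that averaging with it
reproduces monogenic functions up to a constant factor. -/
noncomputable def meanKernel (t : ℝ) (z : Pt n) : ℝ :=
  ((n : ℝ) + 1) * smoothPow ((n : ℝ) + 1) t (‖z‖ ^ 2) +
    2 * ‖z‖ ^ 2 * deriv (smoothPow ((n : ℝ) + 1) t) (‖z‖ ^ 2)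

theorem contDiff_meanKernel (t : ℝ) : ContDiff ℝ ∞ (meanKernel (n := n) t) :=
  (contDiff_const.mul ((contDiff_smoothPow _ t).comp (contDiff_norm_sq ℝ))).add
    ((contDiff_const.mul (contDiff_norm_sq ℝ)).mul
      ((contDiff_deriv_smoothPow _ t).comp (contDiff_norm_sq ℝ)))

theorem continuous_meanKernel (t : ℝ) : Continuous (meanKernel (n := n) t) :=
  (contDiff_meanKernel t).continuous

/-- Infinitesimal form of homogeneity: `2sp' = -mp` for `p(s) = s^{-m/2}`. This says that the Cauchy
kernel is annihilated by `D` from the right away from its pole. -/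
theorem power_kernel_eq_zero {m t s : ℝ} (ht : 0 < t) (hs : t ^ 2 < s) :
    m * smoothPow m t s + 2 * s * deriv (smoothPow m t) s = 0 := by
  have hs0 : 0 < s := (pow_pos ht 2).trans hs
  rw [smoothPow_of_le ht hs.le, deriv_smoothPow_of_lt ht hs, Real.rpow_sub_one hs0.ne']
  field_simp
  ring

theorem meanKernel_eq_zero {t : ℝ} (ht : 0 < t) {z : Pt n} (hz : t < ‖z‖) :
    meanKernel t z = 0 :=
  power_kernel_eq_zero ht (pow_lt_pow_left₀ hz ht.le two_ne_zero)

theorem tsupport_meanKernel_sub {t : ℝ} (ht : 0 < t) (x : Pt n) :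
    tsupport (fun y => meanKernel t (y - x)) ⊆ closedBall x t := by
  refine closure_minimal (fun y hy => ?_) isClosed_closedBall
  rw [mem_closedBall, dist_eq_norm]
  by_contra h
  exact hy (meanKernel_eq_zero ht (not_le.mp h))

theorem hasCompactSupport_meanKernel_sub {t : ℝ} (ht : 0 < t) (x : Pt n) :
    HasCompactSupport (fun y => meanKernel t (y - x)) :=
  (isCompact_closedBall x t).of_isClosed_subset (isClosed_tsupport _) (tsupport_meanKernel_sub ht x)

theorem hasCompactSupport_meanKernel {t : ℝ} (ht : 0 < t) :
    HasCompactSupport (meanKernel (n := n) t) := by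
  simpa using hasCompactSupport_meanKernel_sub ht (0 : Pt n)

theorem smoothPow_one (m : ℝ) : smoothPow m 1 = cutPow m := by
  ext s
  simp [smoothPow]

/-- The smoothing is a rescaling of the one at `t = 1`, so the kernels form an approximate-identity
family and their integral does not depend on `t`. -/
theorem meanKernel_smul {t : ℝ} (ht : 0 < t) (z : Pt n) :
    t ^ (n + 1) * meanKernel t (t • z) = meanKernel 1 z := by
  have h1 : (t ^ 2) ^ (-(((n : ℝ) + 1) / 2)) = (t ^ (n + 1))⁻¹ := by
    rw [← Real.rpow_natCast t 2, ← Real.rpow_mul ht.le, ← Real.rpow_natCast t (n + 1),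
      ← Real.rpow_neg ht.le]
    congr 1
    push_cast
    ring
  have h2 : ‖t • z‖ ^ 2 / t ^ 2 = ‖z‖ ^ 2 := by
    rw [norm_smul, mul_pow, Real.norm_eq_abs, sq_abs]
    field_simp
  rw [meanKernel, meanKernel, smoothPow_one, smoothPow, deriv_smoothPow, h2, h1]
  have h3 : ‖t • z‖ ^ 2 = t ^ 2 * ‖z‖ ^ 2 := by
    rw [norm_smul, mul_pow, Real.norm_eq_abs, sq_abs]
  rw [h3]
  field_simp

/-- The area of the unit sphere in `ℝ^{n+1}`, as a multiple of the volume of the unit ball. -/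
noncomputable def sphereArea (n : ℕ) : ℝ := ((n : ℝ) + 1) * volume.real (ball (0 : Pt n) 1)

theorem sphereArea_eq (n : ℕ) :
    sphereArea n = 2 * Real.pi ^ (((n : ℝ) + 1) / 2) / Real.Gamma (((n : ℝ) + 1) / 2) := by
  have hm : (0 : ℝ) < ((n : ℝ) + 1) / 2 := by positivity
  have hG := Real.Gamma_pos_of_pos hm
  have hpi : √Real.pi ^ (n + 1) = Real.pi ^ (((n : ℝ) + 1) / 2) := by
    rw [Real.sqrt_eq_rpow, ← Real.rpow_natCast, ← Real.rpow_mul Real.pi_pos.le]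
    congr 1
    push_cast
    ring
  rw [sphereArea, measureReal_def, EuclideanSpace.volume_ball, Fintype.card_fin, hpi]
  push_cast
  rw [Real.Gamma_add_one hm.ne', ENNReal.ofReal_one, one_pow, one_mul,
    ENNReal.toReal_ofReal (by positivity)]
  field_simp

theorem sphereArea_pos (n : ℕ) : 0 < sphereArea n := by
  rw [sphereArea_eq]
  have hG := Real.Gamma_pos_of_pos (show (0 : ℝ) < ((n : ℝ) + 1) / 2 by positivity)
  positivity

theorem integral_meanKernel_one : ∫ z : Pt n, meanKernel 1 z = sphereArea n := by
  set m : ℝ := (n : ℝ) + 1 with hm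
  set F : ℝ → ℝ := fun r => m * smoothPow m 1 (r ^ 2) + 2 * r ^ 2 * deriv (smoothPow m 1) (r ^ 2)
    with hF
  have h := integral_fun_norm_addHaar (volume : Measure (Pt n)) F
  have hk : (fun z : Pt n => meanKernel 1 z) = fun z => F ‖z‖ := rfl
  have hcont : Continuous F :=
    (continuous_const.mul ((contDiff_smoothPow m 1).continuous.comp (continuous_pow 2))).add
      ((continuous_const.mul (continuous_pow 2)).mul
        ((contDiff_deriv_smoothPow m 1).continuous.comp (continuous_pow 2)))
  -- In polar coordinates the integrand is the exact derivative of `r^{n+1} p(r²)` with `p =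
  -- smoothPow m 1`, which is `0` at the origin and `1` for `r ≥ 1`.
  have hone : ∫ r in Set.Ioi (0 : ℝ), r ^ n * F r = 1 := by
    have hd (r : ℝ) : HasDerivAt (fun r => r ^ (n + 1) * smoothPow m 1 (r ^ 2)) (r ^ n * F r) r := by
      refine ((hasDerivAt_pow (n + 1) r).fun_mul
        (HasDerivAt.comp (h₂ := smoothPow m 1) r
          ((differentiable_smoothPow m 1) (r ^ 2)).hasDerivAt (hasDerivAt_pow 2 r))).congr_deriv ?_
      simp only [hF, hm, Function.comp_apply]
      push_cast
      ring
    rw [integral_Ioi_of_hasDerivAt_of_tendsto' (fun r _ => hd r) (m := 1)]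
    · simp
    · refine (Continuous.integrable_of_hasCompactSupport ((continuous_pow n).mul hcont)
        ((isCompact_closedBall (0 : ℝ) 1).of_isClosed_subset (isClosed_tsupport _)
          (closure_minimal (fun r hr => ?_) isClosed_closedBall))).integrableOn
      rw [mem_closedBall_zero_iff, Real.norm_eq_abs]
      by_contra hlt
      refine hr ?_
      have : F r = 0 := power_kernel_eq_zero one_pos (by
        rw [← sq_abs r]
        exact pow_lt_pow_left₀ (not_le.mp hlt) zero_le_one two_ne_zero)
      simp [this]
    · refine tendsto_const_nhds.congr' ?_
      filter_upwards [eventually_ge_atTop 1] with r hr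
      have hr0 : 0 < r := by linarith
      rw [smoothPow_of_le one_pos (pow_le_pow_left₀ zero_le_one hr 2), ← Real.rpow_natCast r 2,
        ← Real.rpow_mul hr0.le, ← Real.rpow_natCast r (n + 1), ← Real.rpow_add hr0, hm]
      push_cast
      rw [show (n : ℝ) + 1 + 2 * -(((n : ℝ) + 1) / 2) = 0 by ring, Real.rpow_zero]
  rw [hk, h, finrank_euclideanSpace_fin]
  simp only [Nat.add_sub_cancel, smul_eq_mul, hone, mul_one, nsmul_eq_mul, sphereArea]
  push_cast
  rfl

/-! ### The mean value property -/

theorem contDiff_meanKernel_smul {Ω : Set (Pt n)} (hΩ : IsOpen Ω) {f : Pt n → Cl n}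
    (hf : ContDiffOn ℝ 1 f Ω) {x : Pt n} {t : ℝ} (ht : 0 < t) (hx : closedBall x t ⊆ Ω) :
    ContDiff ℝ 1 (fun y => meanKernel t (y - x) • f y) := by
  have hk : ContDiff ℝ 1 (fun y => meanKernel t (y - x)) :=
    ((contDiff_meanKernel t).of_le (by simp)).comp (contDiff_id.sub contDiff_const)
  have h := contDiff_mul_of_tsupport_subset hΩ (W := fun y => meanKernel t (y - x) • (1 : Cl n))
    (ContDiff.fun_smul hk contDiff_const) ((tsupport_smul_subset_left _ _).trans
        ((tsupport_meanKernel_sub ht x).trans hx)) hf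
  simpa using h

theorem integrable_meanKernel_smul {Ω : Set (Pt n)} (hΩ : IsOpen Ω) {f : Pt n → Cl n}
    (hf : ContDiffOn ℝ 1 f Ω) {x : Pt n} {t : ℝ} (ht : 0 < t) (hx : closedBall x t ⊆ Ω) :
    Integrable (fun y => meanKernel t (y - x) • f y) :=
  (contDiff_meanKernel_smul hΩ hf ht hx).continuous.integrable_of_hasCompactSupport
    (hasCompactSupport_meanKernel_sub ht x).smul_right

/-- The two smoothings of the Cauchy kernel coincide beyond radius `t`. Their difference is thus a
compactly supported field `W` in `Ω`, and `D` applied to it from the right gives the difference of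
the two mean kernels. -/
theorem integral_meanKernel_smul_eq {ε : ℝ} (hε : ε * ε = 1) {Ω : Set (Pt n)} (hΩ : IsOpen Ω)
    {f : Pt n → Cl n} (hf : ContDiffOn ℝ 1 f Ω) (hDf : ∀ y ∈ Ω, cauchyRiemann ε f y = 0)
    {x : Pt n} {s t : ℝ} (hs : 0 < s) (hst : s ≤ t) (hx : closedBall x t ⊆ Ω) :
    ∫ y, meanKernel s (y - x) • f y = ∫ y, meanKernel t (y - x) • f y := by
  have ht : 0 < t := hs.trans_le hst
  set m : ℝ := (n : ℝ) + 1 with hm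
  set P : ℝ → ℝ := fun r => smoothPow m s r - smoothPow m t r with hP
  have hPd : ContDiff ℝ ∞ P := (contDiff_smoothPow m s).sub (contDiff_smoothPow m t)
  set W : Pt n → Cl n := fun y => P (‖y - x‖ ^ 2) • star (paravector ε (y - x)) with hW
  have hWd : ContDiff ℝ 1 W := by
    refine ContDiff.fun_smul ?_ ?_
    · exact (hPd.of_le (by simp)).comp ((contDiff_norm_sq ℝ).comp (contDiff_id.sub contDiff_const))
    · exact contDiff_star.comp (contDiff_paravector.comp (contDiff_id.sub contDiff_const))
  have hsupp : tsupport W ⊆ closedBall x t := by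
    refine closure_minimal (fun y hy => ?_) isClosed_closedBall
    rw [mem_closedBall, dist_eq_norm]
    by_contra h
    refine hy ?_
    have h1 : t ^ 2 ≤ ‖y - x‖ ^ 2 := pow_le_pow_left₀ ht.le (not_le.mp h).le 2
    have h2 : s ^ 2 ≤ ‖y - x‖ ^ 2 := (pow_le_pow_left₀ hs.le hst 2).trans h1
    simp [hW, hP, smoothPow_of_le ht h1, smoothPow_of_le hs h2]
  have hDW (y : Pt n) : rightCauchyRiemann ε W y * f y =
      meanKernel s (y - x) • f y - meanKernel t (y - x) • f y := by
    have hdd : deriv P (‖y - x‖ ^ 2) =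
        deriv (smoothPow m s) (‖y - x‖ ^ 2) - deriv (smoothPow m t) (‖y - x‖ ^ 2) :=
      deriv_fun_sub (differentiable_smoothPow m s _) (differentiable_smoothPow m t _)
    rw [hW, rightCauchyRiemann_radial hε x y (hPd.differentiable (by simp) _), hdd, smul_one_mul,
      ← sub_smul]
    congr 1
    simp only [meanKernel, hP, hm]
    ring
  have h0 := integral_rightCauchyRiemann_mul_eq_zero hΩ hWd
    ((isCompact_closedBall x t).of_isClosed_subset (isClosed_tsupport _) hsupp)
    (hsupp.trans hx) hf hDf
  simp only [hDW] at h0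
  rw [integral_sub (integrable_meanKernel_smul hΩ hf hs ((closedBall_subset_closedBall hst).trans hx))
    (integrable_meanKernel_smul hΩ hf ht hx)] at h0
  exact sub_eq_zero.mp h0

theorem integral_meanKernel_smul_comp {f : Pt n → Cl n} {x : Pt n} {t : ℝ} (ht : 0 < t) :
    ∫ y, meanKernel t (y - x) • f y = ∫ z, meanKernel 1 z • f (x + t • z) := by
  have h1 : ∫ y, meanKernel t (y - x) • f y = ∫ z, meanKernel t z • f (x + z) := by
    rw [← integral_add_left_eq_self _ x]
    simp
  have h2 := Measure.integral_comp_smul (volume : Measure (Pt n))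
    (fun z => meanKernel t z • f (x + z)) t
  rw [finrank_euclideanSpace_fin, abs_of_pos (by positivity)] at h2
  rw [h1]
  simp only [← meanKernel_smul ht, mul_smul, integral_smul]
  rw [h2, smul_inv_smul₀ (by positivity)]

/-- Monogenic functions have the mean value property. -/
theorem integral_meanKernel_smul {ε : ℝ} (hε : ε * ε = 1) {Ω : Set (Pt n)} (hΩ : IsOpen Ω)
    {f : Pt n → Cl n} (hf : ContDiffOn ℝ 1 f Ω) (hDf : ∀ y ∈ Ω, cauchyRiemann ε f y = 0)
    {x : Pt n} {t : ℝ} (ht : 0 < t) (hx : closedBall x t ⊆ Ω) :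
    ∫ y, meanKernel t (y - x) • f y = sphereArea n • f x := by
  have hxΩ : x ∈ Ω := hx (mem_closedBall_self ht.le)
  obtain ⟨C, hC⟩ := (isCompact_closedBall x t).exists_bound_of_continuousOn
    (hf.continuousOn.mono hx)
  have hsmall : ∀ᶠ s in 𝓝[>] (0 : ℝ), 0 < s ∧ s ≤ t := by
    filter_upwards [Ioc_mem_nhdsGT ht] with s hs using hs
  -- The average does not depend on the radius, so it is computed as the radius shrinks to `0`,
  -- where continuity of `f` at `x` suffices.
  have hlim : Tendsto (fun s : ℝ => ∫ z, meanKernel 1 z • f (x + s • z)) (𝓝[>] 0)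
      (𝓝 (∫ z : Pt n, meanKernel 1 z • f x)) := by
    refine tendsto_integral_filter_of_dominated_convergence (fun z => ‖meanKernel 1 z‖ * C) ?_ ?_ ?_
      ?_
    · filter_upwards [hsmall] with s hs
      have hc := (contDiff_meanKernel_smul hΩ hf hs.1
        ((closedBall_subset_closedBall hs.2).trans hx)).continuous
      -- Nothing is known about `f` outside `Ω`; measurability comes from the product with the
      -- kernel of radius `s`, which is continuous everywhere.
      have : (fun z => meanKernel 1 z • f (x + s • z)) =
          fun z => s ^ (n + 1) • (meanKernel s (x + s • z - x) • f (x + s • z)) := by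
        ext z
        rw [add_sub_cancel_left, smul_smul, meanKernel_smul hs.1]
      rw [this]
      have hc' : Continuous fun z : Pt n => meanKernel s (x + s • z - x) • f (x + s • z) :=
        hc.comp (f := fun z => x + s • z) (by fun_prop)
      exact (hc'.const_smul (s ^ (n + 1))).aestronglyMeasurable
    · filter_upwards [hsmall] with s hs
      refine Eventually.of_forall fun z => ?_
      rw [norm_smul]
      by_cases hz : ‖z‖ ≤ 1
      · refine mul_le_mul_of_nonneg_left (hC _ ?_) (norm_nonneg _)
        rw [mem_closedBall, dist_self_add_left, norm_smul, Real.norm_of_nonneg hs.1.le]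
        nlinarith [hs.1, hs.2, norm_nonneg z]
      · simp [meanKernel_eq_zero one_pos (not_le.mp hz)]
    · exact ((continuous_meanKernel 1).integrable_of_hasCompactSupport
        (hasCompactSupport_meanKernel one_pos)).norm.mul_const C
    · refine Eventually.of_forall fun z => Tendsto.const_smul ?_ _
      have hfc : ContinuousAt f x := hf.continuousOn.continuousAt (hΩ.mem_nhds hxΩ)
      have : Tendsto (fun s : ℝ => x + s • z) (𝓝[>] 0) (𝓝 x) := by
        have : Continuous fun s : ℝ => x + s • z := by fun_prop
        simpa using (this.tendsto 0).mono_left nhdsWithin_le_nhds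
      exact hfc.tendsto.comp this
  rw [integral_smul_const, integral_meanKernel_one] at hlim
  refine tendsto_nhds_unique (tendsto_const_nhds.congr' ?_) hlim
  filter_upwards [hsmall] with s hs
  rw [← integral_meanKernel_smul_comp hs.1, integral_meanKernel_smul_eq hε hΩ hf hDf hs.1 hs.2 hx]

/-! ### The Bergman space -/

/-- Point evaluation as integration against a fixed continuous function of compact support, hence
continuous in the `L²` norm. -/
theorem setIntegral_meanKernel_smul {ε : ℝ} (hε : ε * ε = 1) {Ω : Set (Pt n)} (hΩ : IsOpen Ω)
    {f : Pt n → Cl n} (hf : MemBergmanSpace ε Ω f) {x : Pt n} {t : ℝ} (ht : 0 < t)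
    (hx : closedBall x t ⊆ Ω) :
    f x = (sphereArea n)⁻¹ • ∫ y in Ω, meanKernel t (y - x) • f y := by
  rw [setIntegral_eq_integral_of_forall_compl_eq_zero,
    integral_meanKernel_smul hε hΩ hf.contDiffOn hf.equation ht hx,
    inv_smul_smul₀ (sphereArea_pos n).ne']
  intro y hy
  rw [meanKernel_eq_zero ht, zero_smul]
  by_contra h
  exact hy (hx (by rw [mem_closedBall, dist_eq_norm]; exact not_lt.mp h))

/-! ### Limits in `L²` and closedness of the Bergman space. -/

theorem tendsto_setIntegral_smul {Ω : Set (Pt n)} {F : ℕ → Pt n → Cl n} {G : Pt n → Cl n}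
    (hF : ∀ i, MemLp (F i) 2 (volume.restrict Ω)) (hG : MemLp G 2 (volume.restrict Ω))
    (hlim : Tendsto (fun i => eLpNorm (F i - G) 2 (volume.restrict Ω)) atTop (𝓝 0))
    {ψ : Pt n → ℝ} (hψ : Continuous ψ) (hc : HasCompactSupport ψ) :
    Tendsto (fun i => ∫ y in Ω, ψ y • F i y) atTop (𝓝 (∫ y in Ω, ψ y • G y)) := by
  have hψ2 : MemLp ψ 2 (volume.restrict Ω) := hψ.memLp_of_hasCompactSupport hc
  have hle (i : ℕ) : eLpNorm ((fun y => ψ y • F i y) - fun y => ψ y • G y) 1 (volume.restrict Ω) ≤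
      eLpNorm ψ 2 (volume.restrict Ω) * eLpNorm (F i - G) 2 (volume.restrict Ω) := by
    have heq : ((fun y => ψ y • F i y) - fun y => ψ y • G y) = ψ • (F i - G) :=
      funext fun y => (smul_sub (ψ y) (F i y) (G y)).symm
    rw [heq]
    exact eLpNorm_smul_le_mul_eLpNorm ((hF i).1.sub hG.1) hψ2.1
  have hint (i : ℕ) : Integrable (fun y => ψ y • F i y) (volume.restrict Ω) :=
    memLp_one_iff_integrable.mp ((hF i).smul hψ2)
  refine tendsto_integral_of_L1' (fun y => ψ y • G y) (hψ2.1.smul hG.1)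
    (Eventually.of_forall hint) ?_
  have h0 : Tendsto (fun i => eLpNorm ψ 2 (volume.restrict Ω) *
      eLpNorm (F i - G) 2 (volume.restrict Ω)) atTop (𝓝 0) := by
    simpa using ENNReal.Tendsto.const_mul hlim (Or.inr hψ2.eLpNorm_ne_top)
  exact tendsto_of_tendsto_of_tendsto_of_le_of_le tendsto_const_nhds h0 (fun _ => zero_le) hle

theorem hasCompactSupport_fderiv_meanKernel {t : ℝ} (ht : 0 < t) (x v : Pt n) :
    HasCompactSupport (fun y => fderiv ℝ (meanKernel t) (x - y) v) :=
  ((hasCompactSupport_meanKernel ht).fderiv_apply ℝ v).comp_homeomorph (Homeomorph.subLeft x)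

theorem continuous_fderiv_meanKernel (t : ℝ) (x v : Pt n) :
    Continuous (fun y => fderiv ℝ (meanKernel t) (x - y) v) :=
  (((contDiff_meanKernel t).continuous_fderiv (by simp)).comp
    (continuous_const.sub continuous_id)).clm_apply continuous_const

/-- The mean value formula is a convolution, so derivatives fall on the smooth kernel and become
integrals against `g`. Keeping `g` separate from `f` lets `g` be a mere `L²` limit, for which no
equation is yet known. -/
theorem contDiffAt_of_eq_mean {Ω : Set (Pt n)} (hΩ : IsOpen Ω) {f g : Pt n → Cl n}
    (hg : MemLp g 2 (volume.restrict Ω)) {x₀ : Pt n} {t : ℝ} (ht : 0 < t)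
    (hf : ∀ x ∈ ball x₀ t, f x = (sphereArea n)⁻¹ • ∫ y in Ω, meanKernel t (y - x) • g y) :
    ContDiffAt ℝ 1 f x₀ ∧ ∀ v, fderiv ℝ f x₀ v =
      (sphereArea n)⁻¹ • ∫ y in Ω, fderiv ℝ (meanKernel t) (x₀ - y) v • g y := by
  have hloc : LocallyIntegrable (Ω.indicator g) :=
    ((memLp_indicator_iff_restrict hΩ.measurableSet).mpr hg).locallyIntegrable one_le_two
  set L : ℝ →L[ℝ] Cl n →L[ℝ] Cl n := ContinuousLinearMap.lsmul ℝ ℝ with hL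
  have hk1 : ContDiff ℝ 1 (meanKernel (n := n) t) := (contDiff_meanKernel t).of_le (by simp)
  have hkc := hasCompactSupport_meanKernel (n := n) ht
  have heq : f =ᶠ[𝓝 x₀] fun x => (sphereArea n)⁻¹ •
      (meanKernel t ⋆[L, volume] Ω.indicator g) x := by
    filter_upwards [ball_mem_nhds x₀ ht] with x hx
    rw [hf x hx, convolution_eq_swap, ← integral_indicator hΩ.measurableSet]
    congr 2
    ext y
    have : meanKernel t (y - x) = meanKernel t (x - y) := by
      simp only [meanKernel, norm_sub_rev]
    by_cases hy : y ∈ Ω <;> simp [hy, hL, this]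
  have hconv : ContDiff ℝ 1 (meanKernel t ⋆[L, volume] Ω.indicator g) :=
    hkc.contDiff_convolution_left L hk1 hloc
  refine ⟨((hconv.const_smul _).contDiffAt).congr_of_eventuallyEq heq, fun v => ?_⟩
  have hd := hkc.hasFDerivAt_convolution_left L hk1 hloc x₀
  rw [heq.fderiv_eq, (hd.fun_const_smul (sphereArea n)⁻¹).fderiv, smul_apply,
    convolution_eq_swap]
  have hint := ((hkc.fderiv ℝ).convolutionExists_left (ContinuousLinearMap.precompL (Pt n) L)
    (hk1.continuous_fderiv one_ne_zero) hloc x₀).integrable_swap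
  rw [ContinuousLinearMap.integral_apply hint, ← integral_indicator hΩ.measurableSet]
  congr 2
  ext y
  by_cases hy : y ∈ Ω <;> simp [hy, hL]

/-- The Bergman space is closed under limits in `L²`. -/
theorem exists_memBergmanSpace_of_tendsto {ε : ℝ} (hε : ε * ε = 1) {Ω : Set (Pt n)}
    (hΩ : IsOpen Ω) {F : ℕ → Pt n → Cl n} {G : Pt n → Cl n} (hF : ∀ i, MemBergmanSpace ε Ω (F i))
    (hG : MemLp G 2 (volume.restrict Ω))
    (hlim : Tendsto (fun i => eLpNorm (F i - G) 2 (volume.restrict Ω)) atTop (𝓝 0)) :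
    ∃ f, MemBergmanSpace ε Ω f ∧ f =ᵐ[volume.restrict Ω] G := by
  have hpt {x : Pt n} {t : ℝ} (ht : 0 < t) (hx : closedBall x t ⊆ Ω) :
      Tendsto (fun i => F i x) atTop
        (𝓝 ((sphereArea n)⁻¹ • ∫ y in Ω, meanKernel t (y - x) • G y)) := by
    refine ((tendsto_setIntegral_smul (fun i => (hF i).memLp) hG hlim
      ((continuous_meanKernel t).comp (continuous_id.sub continuous_const))
      (hasCompactSupport_meanKernel_sub ht x)).const_smul _).congr fun i => ?_
    exact (setIntegral_meanKernel_smul hε hΩ (hF i) ht hx).symm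
  set f : Pt n → Cl n := fun x => limUnder atTop (fun i => F i x) with hfdef
  have hf {x : Pt n} {t : ℝ} (ht : 0 < t) (hx : closedBall x t ⊆ Ω) :
      f x = (sphereArea n)⁻¹ • ∫ y in Ω, meanKernel t (y - x) • G y := (hpt ht hx).limUnder_eq
  -- One radius must serve all centres near `x`, because the formula is differentiated in the centre
  -- with `t` fixed.
  have hrad {x : Pt n} (hx : x ∈ Ω) : ∃ t > 0, ∀ z ∈ ball x t, closedBall z t ⊆ Ω := by
    obtain ⟨r, hr, hrΩ⟩ := Metric.isOpen_iff.mp hΩ x hx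
    refine ⟨r / 2, by positivity, fun z hz w hw => hrΩ ?_⟩
    rw [mem_ball] at hz ⊢
    rw [mem_closedBall] at hw
    linarith [dist_triangle w z x]
  have hfF {x : Pt n} (hx : x ∈ Ω) : Tendsto (fun i => F i x) atTop (𝓝 (f x)) := by
    obtain ⟨t, ht, hb⟩ := hrad hx
    have := hb x (mem_ball_self ht)
    rw [hf ht this]
    exact hpt ht this
  -- A subsequence converges almost everywhere to `G`, while the whole sequence converges to `f` at
  -- every point of `Ω`.
  have hae : f =ᵐ[volume.restrict Ω] G := by
    obtain ⟨ns, hns, hconv⟩ := (tendstoInMeasure_of_tendsto_eLpNorm two_ne_zero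
      (fun i => (hF i).memLp.1) hG.1 hlim).exists_seq_tendsto_ae
    filter_upwards [hconv, ae_restrict_mem hΩ.measurableSet] with x hx hxΩ
    exact tendsto_nhds_unique ((hfF hxΩ).comp hns.tendsto_atTop) hx
  refine ⟨f, ⟨fun x hx => ?_, fun x hx => ?_, (memLp_congr_ae hae).mpr hG⟩, hae⟩
  · obtain ⟨t, ht, hb⟩ := hrad hx
    exact (contDiffAt_of_eq_mean hΩ hG ht fun z hz => hf ht (hb z hz)).1.contDiffWithinAt
  · obtain ⟨t, ht, hb⟩ := hrad hx
    have h1 := (contDiffAt_of_eq_mean hΩ hG ht fun z hz => hf ht (hb z hz)).2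
    have h2 (i : ℕ) := (contDiffAt_of_eq_mean hΩ (hF i).memLp ht
      fun z hz => setIntegral_meanKernel_smul hε hΩ (hF i) ht (hb z hz)).2
    have h3 : Tendsto (fun i => cauchyRiemann ε (F i) x) atTop (𝓝 (cauchyRiemann ε f x)) := by
      simp only [cauchyRiemann_eq_sum, pderiv, h1, h2]
      refine tendsto_finsetSum _ fun k _ => Tendsto.const_mul _ (Tendsto.const_smul ?_ _)
      exact tendsto_setIntegral_smul (fun i => (hF i).memLp) hG hlim
        (continuous_fderiv_meanKernel t x _) (hasCompactSupport_fderiv_meanKernel ht x _)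
    refine tendsto_nhds_unique h3 (tendsto_const_nhds.congr fun i => ?_)
    exact ((hF i).equation x hx).symm

/-! ### The Bergman space as a right module. -/

namespace MemBergmanSpace

variable {ε : ℝ} {Ω : Set (Pt n)} {f g : Pt n → Cl n}

theorem differentiableAt (hf : MemBergmanSpace ε Ω f) (hΩ : IsOpen Ω) {y : Pt n} (hy : y ∈ Ω) :
    DifferentiableAt ℝ f y :=
  (hf.contDiffOn.contDiffAt (hΩ.mem_nhds hy)).differentiableAt one_ne_zero

theorem zero : MemBergmanSpace ε Ω (fun _ => (0 : Cl n)) where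
  contDiffOn := contDiffOn_const
  equation y _ := by simp [cauchyRiemann_eq_sum, pderiv]
  memLp := MemLp.zero'

theorem add (hf : MemBergmanSpace ε Ω f) (hg : MemBergmanSpace ε Ω g) (hΩ : IsOpen Ω) :
    MemBergmanSpace ε Ω (fun y => f y + g y) where
  contDiffOn := hf.contDiffOn.add hg.contDiffOn
  equation y hy := by
    have h1 := hf.equation y hy
    have h2 := hg.equation y hy
    simp only [cauchyRiemann_eq_sum, pderiv] at h1 h2 ⊢
    simp [fderiv_fun_add (hf.differentiableAt hΩ hy) (hg.differentiableAt hΩ hy), mul_add,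
      Finset.sum_add_distrib, h1, h2]
  memLp := hf.memLp.add hg.memLp

theorem mul_const (hf : MemBergmanSpace ε Ω f) (hΩ : IsOpen Ω) (c : Cl n) :
    MemBergmanSpace ε Ω (fun y => f y * c) where
  contDiffOn := hf.contDiffOn.mul contDiffOn_const
  equation y hy := by
    have h1 := hf.equation y hy
    rw [cauchyRiemann_eq_sum] at h1 ⊢
    simp only [pderiv_mul_const c (hf.differentiableAt hΩ hy), ← mul_assoc]
    rw [← Finset.sum_mul, h1, zero_mul]
  memLp := ((ContinuousLinearMap.mul ℝ (Cl n)).flip c).comp_memLp' hf.memLp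

theorem const_smul (hf : MemBergmanSpace ε Ω f) (hΩ : IsOpen Ω) (r : ℝ) :
    MemBergmanSpace ε Ω (fun y => r • f y) := by
  simpa [← Algebra.commutes, ← Algebra.smul_def] using hf.mul_const hΩ (algebraMap ℝ (Cl n) r)

theorem sub (hf : MemBergmanSpace ε Ω f) (hg : MemBergmanSpace ε Ω g) (hΩ : IsOpen Ω) :
    MemBergmanSpace ε Ω (fun y => f y - g y) := by
  simpa [sub_eq_add_neg] using hf.add (hg.const_smul hΩ (-1)) hΩ

theorem memLp_star (hf : MemBergmanSpace ε Ω f) :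
    MemLp (fun y => star (f y)) 2 (volume.restrict Ω) :=
  (starL n).comp_memLp' hf.memLp

theorem integrable_star_mul (hf : MemBergmanSpace ε Ω f) (hg : MemBergmanSpace ε Ω g) :
    IntegrableOn (fun y => star (f y) * g y) Ω :=
  hf.memLp_star.integrable_mul hg.memLp

end MemBergmanSpace

/-! ### Existence and uniqueness of the Bergman kernel -/

/-- The dual element `g` is the orthogonal projection onto the Bergman space of the bump function
that represents evaluation at `x`. -/
theorem exists_dual_memBergmanSpace {ε : ℝ} (hε : ε * ε = 1) {Ω : Set (Pt n)} (hΩ : IsOpen Ω)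
    {x : Pt n} (hx : x ∈ Ω) :
    ∃ g, MemBergmanSpace ε Ω g ∧ ∀ f, MemBergmanSpace ε Ω f → ∫ y in Ω, star (g y) * f y = f x := by
  obtain ⟨V, _, _, _, T, hT⟩ := exists_euclidean_equiv n
  set μ : Measure (Pt n) := volume.restrict Ω with hμ
  obtain ⟨t, ht, hball⟩ : ∃ t > 0, closedBall x t ⊆ Ω :=
    nhds_basis_closedBall.mem_iff.mp (hΩ.mem_nhds hx)
  set φ : Cl n →L[ℝ] ℝ := (innerSL ℝ (T 1)).comp (T : Cl n →L[ℝ] V) with hφ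
  have hφT (a b : Cl n) : inner ℝ (T a) (T b) = φ (star a * b) := hT a b
  -- the Bergman space as a closed subspace of `L²`
  let H : Submodule ℝ (Lp V 2 μ) :=
    { carrier := {F | ∃ f, MemBergmanSpace ε Ω f ∧ F =ᵐ[μ] fun y => T (f y)}
      zero_mem' := ⟨_, MemBergmanSpace.zero, by
        filter_upwards [Lp.coeFn_zero V 2 μ] with y hy
        exact hy.trans (by simp)⟩
      add_mem' := by
        rintro F G ⟨f, hf, hFf⟩ ⟨g, hg, hGg⟩
        refine ⟨_, hf.add hg hΩ, ?_⟩
        filter_upwards [Lp.coeFn_add F G, hFf, hGg] with y h1 h2 h3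
        exact h1.trans (by simp [h2, h3])
      smul_mem' := by
        rintro r F ⟨f, hf, hFf⟩
        refine ⟨_, hf.const_smul hΩ r, ?_⟩
        filter_upwards [Lp.coeFn_smul r F, hFf] with y h1 h2
        exact h1.trans (by simp [h2]) }
  have hclosed : IsClosed (H : Set (Lp V 2 μ)) := by
    refine IsSeqClosed.isClosed fun F F₀ hF hlim => ?_
    choose f hf hFf using hF
    rw [Lp.tendsto_Lp_iff_tendsto_eLpNorm'] at hlim
    have hG : MemLp (fun y => T.symm (F₀ y)) 2 μ :=
      (T.symm : V →L[ℝ] Cl n).comp_memLp' (Lp.memLp F₀)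
    have hlim' : Tendsto (fun i => eLpNorm (f i - fun y => T.symm (F₀ y)) 2 μ) atTop (𝓝 0) := by
      have h0 : Tendsto (fun i => ‖(T.symm : V →L[ℝ] Cl n)‖₊ • eLpNorm (⇑(F i) - ⇑F₀) 2 μ) atTop
          (𝓝 0) := by
        simpa [ENNReal.smul_def] using ENNReal.Tendsto.const_mul hlim
          (Or.inr (ENNReal.coe_ne_top (r := ‖(T.symm : V →L[ℝ] Cl n)‖₊)))
      refine tendsto_of_tendsto_of_tendsto_of_le_of_le tendsto_const_nhds h0 (fun _ => zero_le) ?_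
      intro i
      refine eLpNorm_le_nnreal_smul_eLpNorm_of_ae_le_mul ?_ 2
      filter_upwards [hFf i] with y hy
      have : f i y - T.symm (F₀ y) = (T.symm : V →L[ℝ] Cl n) (F i y - F₀ y) := by
        rw [hy]
        simp
      simp only [Pi.sub_apply, this]
      exact ContinuousLinearMap.le_opNNNorm _ _
    obtain ⟨f₀, hf₀, hae⟩ := exists_memBergmanSpace_of_tendsto hε hΩ hf hG hlim'
    refine ⟨f₀, hf₀, ?_⟩
    filter_upwards [hae] with y hy
    rw [hy, ContinuousLinearEquiv.apply_symm_apply]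
  have : CompleteSpace H := hclosed.completeSpace_coe
  set ψ : Pt n → ℝ := fun y => (sphereArea n)⁻¹ * meanKernel t (y - x) with hψ
  have hψc : HasCompactSupport ψ := (hasCompactSupport_meanKernel_sub ht x).mul_left
  have hψcont : Continuous ψ :=
    continuous_const.mul ((continuous_meanKernel t).comp (continuous_id.sub continuous_const))
  have hu : MemLp (fun y => ψ y • T 1) 2 μ :=
    (hψcont.smul continuous_const).memLp_of_hasCompactSupport hψc.smul_right
  set u : Lp V 2 μ := hu.toLp with hudef
  obtain ⟨g, hg, hgae⟩ := H.starProjection_apply_mem u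
  have hpair (f : Pt n → Cl n) (hf : MemBergmanSpace ε Ω f) :
      φ (∫ y in Ω, star (g y) * f y) = φ (f x) := by
    have hTf : MemLp (fun y => T (f y)) 2 μ := (T : Cl n →L[ℝ] V).comp_memLp' hf.memLp
    have h0 := H.starProjection_inner_eq_zero u (hTf.toLp _) ⟨f, hf, hTf.coeFn_toLp⟩
    rw [inner_sub_left, sub_eq_zero, L2.inner_def, L2.inner_def] at h0
    have h1 : ∫ y, inner ℝ (u y) ((hTf.toLp _) y) ∂μ = φ (f x) := by
      have : ∫ y, inner ℝ (u y) ((hTf.toLp _) y) ∂μ = ∫ y in Ω, φ (ψ y • f y) := by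
        refine integral_congr_ae ?_
        filter_upwards [hu.coeFn_toLp, hTf.coeFn_toLp] with y h1 h2
        rw [h1, h2, real_inner_smul_left, map_smul, smul_eq_mul]
        rfl
      rw [this, φ.integral_comp_comm]
      · conv_rhs => rw [setIntegral_meanKernel_smul hε hΩ hf ht hball, ← integral_smul]
        simp only [hψ, mul_smul]
      · exact memLp_one_iff_integrable.mp
          (hf.memLp.smul (hψcont.memLp_of_hasCompactSupport (p := 2) hψc))
    have h2 : ∫ y, inner ℝ (H.starProjection u y) ((hTf.toLp _) y) ∂μ =
        φ (∫ y in Ω, star (g y) * f y) := by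
      rw [← φ.integral_comp_comm (hg.integrable_star_mul hf)]
      refine integral_congr_ae ?_
      filter_upwards [hgae, hTf.coeFn_toLp] with y h1 h2
      rw [h1, h2, hφT]
    rw [← h1, ← h2, h0]
  refine ⟨g, hg, fun f hf => ?_⟩
  -- So far only the `φ`-component of the identity is known. Testing with `f c` for all constants
  -- `c` recovers the rest: for `c = star b`, where `b` is the defect, the value is `‖T (star b)‖²`.
  have hac (c : Cl n) : φ (((∫ y in Ω, star (g y) * f y) - f x) * c) = 0 := by
    have h := hpair _ (hf.mul_const hΩ c)
    have h2 : ∫ y in Ω, star (g y) * (f y * c) = (∫ y in Ω, star (g y) * f y) * c := by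
      have := ((ContinuousLinearMap.mul ℝ (Cl n)).flip c).integral_comp_comm
        (hg.integrable_star_mul hf)
      simpa [mul_assoc] using this
    rw [sub_mul, map_sub, ← h2, h, sub_self]
  have hz := hac (star ((∫ y in Ω, star (g y) * f y) - f x))
  set b : Cl n := (∫ y in Ω, star (g y) * f y) - f x with hb
  have h0 : inner ℝ (T (star b)) (T (star b)) = (0 : ℝ) := by
    rw [hφT, star_star, hz]
  rw [inner_self_eq_zero, map_eq_zero_iff _ T.injective, star_eq_zero] at h0
  exact sub_eq_zero.mp h0

theorem exists_isBergmanKernel {ε : ℝ} (hε : ε * ε = 1) {Ω : Set (Pt n)} (hΩ : IsOpen Ω) :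
    ∃ B, IsBergmanKernel ε Ω B := by
  classical
  choose g hg using fun x : Ω => exists_dual_memBergmanSpace hε hΩ x.2
  refine ⟨fun x y => if hx : x ∈ Ω then star (g ⟨x, hx⟩ y) else 0, ⟨fun x hx => ?_,
    fun f hf x hx => ?_⟩⟩
  · simpa [hx] using (hg ⟨x, hx⟩).1
  · simpa [hx] using (hg ⟨x, hx⟩).2 f hf

theorem isBergmanKernel_bergmanKernel {ε : ℝ} (hε : ε * ε = 1) {Ω : Set (Pt n)} (hΩ : IsOpen Ω) :
    IsBergmanKernel ε Ω (bergmanKernel ε Ω) := by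
  have h := exists_isBergmanKernel hε hΩ
  rw [bergmanKernel, dif_pos h]
  exact h.choose_spec

/-- The functional `φ` sends `star h * h` to `‖T h‖²`, so `h` vanishes almost everywhere, and by
continuity everywhere in the open set. -/
theorem MemBergmanSpace.eq_zero_of_integral {ε : ℝ} {Ω : Set (Pt n)} (hΩ : IsOpen Ω)
    {h : Pt n → Cl n} (hh : MemBergmanSpace ε Ω h) (h0 : ∫ y in Ω, star (h y) * h y = 0)
    {y : Pt n} (hy : y ∈ Ω) : h y = 0 := by
  obtain ⟨V, _, _, _, T, hT⟩ := exists_euclidean_equiv n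
  set φ : Cl n →L[ℝ] ℝ := (innerSL ℝ (T 1)).comp (T : Cl n →L[ℝ] V) with hφ
  have hφT (a : Cl n) : φ (star a * a) = ‖T a‖ ^ 2 := by
    rw [← real_inner_self_eq_norm_sq, hT]
    rfl
  have h1 := φ.integral_comp_comm (hh.integrable_star_mul hh)
  have hint := φ.integrable_comp (hh.integrable_star_mul hh)
  rw [h0, map_zero] at h1
  simp only [hφT] at h1 hint
  rw [integral_eq_zero_iff_of_nonneg (fun _ => by positivity) hint] at h1
  refine Measure.eqOn_open_of_ae_eq (f := h) (g := fun _ => 0) (μ := volume) ?_ hΩ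
    hh.contDiffOn.continuousOn continuousOn_const hy
  filter_upwards [h1] with z hz
  simpa using hz

/-- Both kernels reproduce the difference `h` of their conjugates at `x`, so `∫ star h * h = h x - h
x = 0`. -/
theorem IsBergmanKernel.unique {ε : ℝ} {Ω : Set (Pt n)} (hΩ : IsOpen Ω) {B B' : Pt n → Pt n → Cl n}
    (hB : IsBergmanKernel ε Ω B) (hB' : IsBergmanKernel ε Ω B') {x y : Pt n} (hx : x ∈ Ω)
    (hy : y ∈ Ω) : B x y = B' x y := by
  have hh := (hB.mem x hx).sub (hB'.mem x hx) hΩ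
  have h0 := hh.eq_zero_of_integral hΩ (by
    have h1 := hB.reproducing _ hh x hx
    have h2 := hB'.reproducing _ hh x hx
    have i1 := (hB.mem x hx).integrable_star_mul hh
    have i2 := (hB'.mem x hx).integrable_star_mul hh
    simp only [star_star] at i1 i2
    simp only [star_sub, star_star, sub_mul _ _ (star _ - star _)]
    rw [integral_sub i1 i2, h1, h2, sub_self]) hy
  exact star_injective (sub_eq_zero.mp h0)

/-! ### Reduction of `λ`-monogenic functions to monogenic functions -/

theorem IsLambdaMonogenic.memBergmanSpace {ε : ℝ} {Ω : Set (Pt n)} (hΩ : IsOpen Ω) {lam : Cl n}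
    {f : Pt n → Cl n} (hf : IsLambdaMonogenic ε lam Ω f)
    (hL : Bornology.IsBounded Ω ∨
      MemLp (fun y => f y * NormedSpace.exp ((-y 0) • lam)) 2 (volume.restrict Ω)) :
    MemBergmanSpace ε Ω (fun y => f y * NormedSpace.exp ((-y 0) • lam)) := by
  set E : Pt n → Cl n := fun y => NormedSpace.exp ((-y 0) • lam) with hE
  have hEd (y : Pt n) : HasFDerivAt E
      ((-(EuclideanSpace.proj 0 : Pt n →L[ℝ] ℝ)).smulRight (lam * E y)) y := by
    have h1 := hasDerivAt_exp_smul_const' lam (-y 0)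
    have h2 : HasFDerivAt (fun y : Pt n => -y 0) (-(EuclideanSpace.proj 0 : Pt n →L[ℝ] ℝ)) y :=
      (EuclideanSpace.proj 0 : Pt n →L[ℝ] ℝ).hasFDerivAt.neg
    have h3 := h1.hasFDerivAt.comp y h2
    refine h3.congr_fderiv ?_
    ext v
    simp [hE]
  have hEcont : Continuous E := continuous_iff_continuousAt.mpr fun y => (hEd y).continuousAt
  have hEC : ContDiff ℝ 1 E := by
    rw [contDiff_one_iff_fderiv]
    refine ⟨fun y => (hEd y).differentiableAt, ?_⟩
    have : fderiv ℝ E = fun y =>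
        ContinuousLinearMap.smulRightL ℝ (Pt n) (Cl n) (-(EuclideanSpace.proj 0 : Pt n →L[ℝ] ℝ))
          (lam * E y) := funext fun y => (hEd y).fderiv
    rw [this]
    exact (ContinuousLinearMap.continuous _).comp (continuous_const.mul hEcont)
  refine ⟨hf.contDiffOn.mul hEC.contDiffOn, fun y hy => ?_, hL.elim (fun hb => ?_) id⟩
  · have hfd : DifferentiableAt ℝ f y :=
      (hf.contDiffOn.contDiffAt (hΩ.mem_nhds hy)).differentiableAt one_ne_zero
    -- Only the `y₀` derivative of the exponential survives, and its direction is `1`; keeping `lam`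
    -- to the left of `E` makes the term `-f λ E`, opposite to `(Df)E`.
    have hp (k : Fin (n + 1)) : pderiv k E y = if k = 0 then -(lam * E y) else 0 := by
      rw [pderiv, (hEd y).fderiv]
      rcases eq_or_ne k 0 with rfl | hk
      · simp
      · simp [hk, hk.symm]
    have h1 := hf.equation y hy
    rw [cauchyRiemann_eq_sum] at h1 ⊢
    have hprod (k : Fin (n + 1)) : pderiv k (fun y => f y * NormedSpace.exp ((-y 0) • lam)) y =
        f y * pderiv k E y + pderiv k f y * E y := pderiv_mul hfd (hEd y).differentiableAt
    simp only [hprod, hp, mul_add, Finset.sum_add_distrib, ← mul_assoc]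
    rw [← Finset.sum_mul, h1]
    simp [mul_assoc]
  · have hcpt : IsCompact (closure Ω) := hb.isCompact_closure
    obtain ⟨C, hC⟩ := hcpt.exists_bound_of_continuousOn
      (hf.continuousOn_closure.mul hEcont.continuousOn)
    have : IsFiniteMeasure (volume.restrict Ω) := ⟨by
      rw [Measure.restrict_apply_univ]
      exact hb.measure_lt_top⟩
    refine MemLp.of_bound ((hf.contDiffOn.continuousOn.mul
      hEcont.continuousOn).aestronglyMeasurable hΩ.measurableSet) C ?_
    filter_upwards [ae_restrict_mem hΩ.measurableSet] with y hy
    exact hC y (subset_closure hy)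

theorem exp_add_smul (lam : Cl n) (a b : ℝ) : NormedSpace.exp ((a + b) • lam) =
    NormedSpace.exp (a • lam) * NormedSpace.exp (b • lam) := by
  let _ : NormedAlgebra ℚ (Cl n) := NormedAlgebra.restrictScalars ℚ ℝ (Cl n)
  rw [add_smul, NormedSpace.exp_add_of_commute (((Commute.refl lam).smul_left a).smul_right b)]

theorem IsBergmanKernel.lambda_reproducing {ε : ℝ} {Ω : Set (Pt n)} (hΩ : IsOpen Ω)
    {B : Pt n → Pt n → Cl n} (hB : IsBergmanKernel ε Ω B) {lam : Cl n}
    {f : Pt n → Cl n} (hf : IsLambdaMonogenic ε lam Ω f)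
    (hL : Bornology.IsBounded Ω ∨
      MemLp (fun y => f y * NormedSpace.exp ((-y 0) • lam)) 2 (volume.restrict Ω))
    {x : Pt n} (hx : x ∈ Ω) :
    IntegrableOn (fun y => B x y * (f y * NormedSpace.exp ((x 0 - y 0) • lam))) Ω ∧
      ∫ y in Ω, B x y * (f y * NormedSpace.exp ((x 0 - y 0) • lam)) = f x := by
  have hg := hf.memBergmanSpace hΩ hL
  set c : Cl n := NormedSpace.exp (x 0 • lam) with hc
  have hgc := hg.mul_const hΩ c
  -- The factor `e^{x₀λ}` is constant in `y` and multiplies on the right, so the Bergman space is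
  -- preserved.
  have heq : (fun y => f y * NormedSpace.exp ((-y 0) • lam) * c) =
      fun y => f y * NormedSpace.exp ((x 0 - y 0) • lam) := by
    ext y
    rw [mul_assoc, hc, ← exp_add_smul, neg_add_eq_sub]
  rw [heq] at hgc
  have hi := (hB.mem x hx).integrable_star_mul hgc
  simp only [star_star] at hi
  refine ⟨hi, (hB.reproducing _ hgc x hx).trans ?_⟩
  simp

/-! ### The divergence theorem on the unit ball -/

theorem deriv_smoothTransition_of_one_lt {s : ℝ} (hs : 1 < s) :
    deriv Real.smoothTransition s = 0 := by
  have : Real.smoothTransition =ᶠ[𝓝 s] fun _ => 1 := by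
    filter_upwards [Ioi_mem_nhds hs] with r hr
    exact Real.smoothTransition.one_of_one_le (le_of_lt hr)
  rw [this.deriv_eq, deriv_const]

theorem exists_bound_deriv_smoothTransition :
    ∃ M, 0 ≤ M ∧ ∀ s, ‖deriv Real.smoothTransition s‖ ≤ M := by
  have hc : Continuous (deriv Real.smoothTransition) :=
    (Real.smoothTransition.contDiff (n := 1)).continuous_deriv le_rfl
  obtain ⟨M, hM⟩ := (isCompact_Icc (a := (0 : ℝ)) (b := 1)).exists_bound_of_continuousOn
    hc.continuousOn
  have hM0 : 0 ≤ M := (norm_nonneg _).trans (hM 0 (by simp))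
  refine ⟨M, hM0, fun s => ?_⟩
  by_cases h0 : s < 0
  · have : Real.smoothTransition =ᶠ[𝓝 s] fun _ => 0 := by
      filter_upwards [Iio_mem_nhds h0] with r hr
      exact Real.smoothTransition.zero_of_nonpos (le_of_lt hr)
    rw [this.deriv_eq]
    simpa using hM0
  by_cases h1 : 1 < s
  · rwa [deriv_smoothTransition_of_one_lt h1, norm_zero]
  · exact hM s ⟨not_lt.mp h0, not_lt.mp h1⟩

theorem exists_unit_norm_sub_eq (y : Pt n) (hy : ‖y‖ ≤ 1) :
    ∃ z : Pt n, ‖z‖ = 1 ∧ ‖y - z‖ = 1 - ‖y‖ := by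
  by_cases h : y = 0
  · refine ⟨EuclideanSpace.single 0 1, by simp, by simp [h]⟩
  · have hn : 0 < ‖y‖ := norm_pos_iff.mpr h
    refine ⟨‖y‖⁻¹ • y, by rw [norm_smul, norm_inv, norm_norm, inv_mul_cancel₀ hn.ne'], ?_⟩
    have : y - ‖y‖⁻¹ • y = (1 - ‖y‖⁻¹) • y := by rw [sub_smul, one_smul]
    rw [this, norm_smul, Real.norm_eq_abs, abs_of_nonpos (sub_nonpos.mpr ((one_le_inv₀ hn).mpr hy))]
    field_simp
    ring

/-- Mean value inequality along the segment to a nearest point of the sphere, at distance `1 - ‖y‖ ≤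
1 - ‖y‖²`. -/
theorem exists_bound_of_eq_zero_on_sphere {W : Pt n → Cl n} (hW : ContDiff ℝ 1 W)
    (h0 : ∀ y, ‖y‖ = 1 → W y = 0) :
    ∃ L, 0 ≤ L ∧ ∀ y, ‖y‖ ≤ 1 → ‖W y‖ ≤ L * (1 - ‖y‖ ^ 2) := by
  obtain ⟨L, hL⟩ := (isCompact_closedBall (0 : Pt n) 1).exists_bound_of_continuousOn
    (hW.continuous_fderiv one_ne_zero).continuousOn
  have hL0 : 0 ≤ L := (norm_nonneg _).trans (hL 0 (by simp))
  refine ⟨L, hL0, fun y hy => ?_⟩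
  obtain ⟨z, hz, hyz⟩ := exists_unit_norm_sub_eq y hy
  have h := (convex_closedBall (0 : Pt n) 1).norm_image_sub_le_of_norm_fderiv_le
    (fun u _ => hW.differentiable one_ne_zero u) hL (x := z) (y := y) (by simp [hz]) (by simpa)
  rw [h0 z hz, sub_zero, hyz] at h
  refine h.trans (mul_le_mul_of_nonneg_left ?_ hL0)
  nlinarith [norm_nonneg y]

/-- A smooth function of compact support in the unit ball, which tends to `1` for large `i`. -/
noncomputable def ballCutoff (i : ℕ) (y : Pt n) : ℝ :=
  Real.smoothTransition ((i : ℝ) * (1 - ‖y‖ ^ 2) - 1)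

theorem contDiff_ballCutoff (i : ℕ) : ContDiff ℝ 1 (ballCutoff (n := n) i) :=
  Real.smoothTransition.contDiff.comp
    ((contDiff_const.mul (contDiff_const.sub (contDiff_norm_sq ℝ))).sub contDiff_const)

theorem hasFDerivAt_ballCutoff (i : ℕ) (y : Pt n) :
    HasFDerivAt (ballCutoff i) (innerSL ℝ
      (-(2 * (i : ℝ) * deriv Real.smoothTransition ((i : ℝ) * (1 - ‖y‖ ^ 2) - 1)) • y)) y := by
  have h1 : HasFDerivAt (fun y : Pt n => (i : ℝ) * (1 - ‖y‖ ^ 2) - 1)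
      (innerSL ℝ ((-(2 * (i : ℝ))) • y)) y := by
    refine ((((hasFDerivAt_norm_sq y).const_sub 1).const_mul (i : ℝ)).sub_const 1).congr_fderiv ?_
    ext v
    simp
    ring
  have h2 := hasFDerivAt_comp_innerSL (P := Real.smoothTransition)
    (((Real.smoothTransition.contDiff (n := 1)).differentiable one_ne_zero _).hasDerivAt) h1
  have h3 : -(2 * (i : ℝ) * deriv Real.smoothTransition ((i : ℝ) * (1 - ‖y‖ ^ 2) - 1)) • y =
      deriv Real.smoothTransition ((i : ℝ) * (1 - ‖y‖ ^ 2) - 1) • (-(2 * (i : ℝ))) • y := by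
    rw [smul_smul]
    congr 1
    ring
  rw [h3]
  exact h2

theorem ballCutoff_eq_zero {i : ℕ} {y : Pt n} (h : (i : ℝ) * (1 - ‖y‖ ^ 2) ≤ 1) :
    ballCutoff i y = 0 :=
  Real.smoothTransition.zero_of_nonpos (by linarith)

theorem tsupport_ballCutoff {i : ℕ} :
    tsupport (ballCutoff (n := n) i) ⊆ {y | 1 ≤ (i : ℝ) * (1 - ‖y‖ ^ 2)} := by
  refine closure_minimal (fun y hy => ?_) (isClosed_le continuous_const (by fun_prop))
  by_contra h
  exact hy (ballCutoff_eq_zero (not_le.mp h).le)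

theorem tsupport_ballCutoff_subset_ball {i : ℕ} :
    tsupport (ballCutoff (n := n) i) ⊆ ball 0 1 := by
  intro y hy
  have h : 1 ≤ (i : ℝ) * (1 - ‖y‖ ^ 2) := tsupport_ballCutoff hy
  rw [mem_ball_zero_iff]
  by_contra hlt
  have : (i : ℝ) * (1 - ‖y‖ ^ 2) ≤ 0 :=
    mul_nonpos_of_nonneg_of_nonpos (Nat.cast_nonneg i) (by nlinarith [not_lt.mp hlt])
  linarith

theorem continuous_rightCauchyRiemann (ε : ℝ) {W : Pt n → Cl n} (hW : ContDiff ℝ 1 W) :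
    Continuous (rightCauchyRiemann ε W) :=
  continuous_finsetSum _ fun _ _ =>
    ((hW.continuous_fderiv one_ne_zero).clm_apply continuous_const).mul continuous_const

theorem eventually_two_lt_mul {y : Pt n} (hy : ‖y‖ < 1) :
    ∀ᶠ i : ℕ in atTop, 2 < (i : ℝ) * (1 - ‖y‖ ^ 2) := by
  have hpos : 0 < 1 - ‖y‖ ^ 2 := by nlinarith [norm_nonneg y]
  exact (tendsto_natCast_atTop_atTop.atTop_mul_const hpos).eventually_gt_atTop 2

/-- As `f` is only square integrable it may have no boundary values, so `W` is cut off inside the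
ball. The gradient of the cutoff grows like `i`, but on its support `W` is of order `1/i`; the
products stay bounded and dominated convergence applies. -/
theorem integral_ball_rightCauchyRiemann_mul_eq_zero {ε : ℝ} {W f : Pt n → Cl n}
    (hW : ContDiff ℝ 1 W) (h0 : ∀ y, ‖y‖ = 1 → W y = 0) (hf : MemBergmanSpace ε (ball 0 1) f) :
    ∫ y in ball 0 1, rightCauchyRiemann ε W y * f y = 0 := by
  have hWi (i : ℕ) : ContDiff ℝ 1 (fun y => ballCutoff i y • W y) :=
    (contDiff_ballCutoff i).fun_smul hW
  have hsupp (i : ℕ) : tsupport (fun y => ballCutoff i y • W y) ⊆ ball 0 1 :=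
    (tsupport_smul_subset_left _ _).trans tsupport_ballCutoff_subset_ball
  have hcomp (i : ℕ) : HasCompactSupport (fun y => ballCutoff i y • W y) :=
    (isCompact_closedBall (0 : Pt n) 1).of_isClosed_subset (isClosed_tsupport _)
      ((hsupp i).trans ball_subset_closedBall)
  have hzero (i : ℕ) :
      ∫ y in ball 0 1, rightCauchyRiemann ε (fun y => ballCutoff i y • W y) y * f y = 0 := by
    rw [setIntegral_eq_integral_of_forall_compl_eq_zero]
    · exact integral_rightCauchyRiemann_mul_eq_zero isOpen_ball (hWi i) (hcomp i) (hsupp i)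
        hf.contDiffOn hf.equation
    · intro y hy
      have h1 := notMem_tsupport_iff_eventuallyEq.mp (fun h => hy (hsupp i h))
      have h2 : fderiv ℝ (fun y => ballCutoff i y • W y) y = 0 := by
        rw [h1.fderiv_eq]
        simp
      simp [rightCauchyRiemann, pderiv, h2]
  set c : ℕ → Pt n → ℝ := fun i y =>
    -(2 * (i : ℝ) * deriv Real.smoothTransition ((i : ℝ) * (1 - ‖y‖ ^ 2) - 1)) with hc
  have hD (i : ℕ) (y : Pt n) : rightCauchyRiemann ε (fun y => ballCutoff i y • W y) y =
      ballCutoff i y • rightCauchyRiemann ε W y + W y * paravector ε (c i y • y) :=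
    rightCauchyRiemann_smul ε (hasFDerivAt_ballCutoff i y) (hW.differentiable one_ne_zero y)
  obtain ⟨M, hM0, hM⟩ := exists_bound_deriv_smoothTransition
  obtain ⟨L, hL0, hL⟩ := exists_bound_of_eq_zero_on_sphere hW h0
  obtain ⟨C, hC⟩ := (isCompact_closedBall (0 : Pt n) 1).exists_bound_of_continuousOn
    (continuous_rightCauchyRiemann ε hW).continuousOn
  have hfin : IsFiniteMeasure (volume.restrict (ball (0 : Pt n) 1)) :=
    ⟨by rw [Measure.restrict_apply_univ]; exact measure_ball_lt_top⟩
  -- The derivative of the transition vanishes once `i(1 - |y|²) > 2`; otherwise the quantity is at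
  -- most `2 · 2 · M`.
  have hcb (i : ℕ) {y : Pt n} (hy : ‖y‖ < 1) : |c i y| * (1 - ‖y‖ ^ 2) ≤ 4 * M := by
    have hpos : 0 < 1 - ‖y‖ ^ 2 := by nlinarith [norm_nonneg y]
    by_cases h2 : 2 < (i : ℝ) * (1 - ‖y‖ ^ 2)
    · simp only [hc, deriv_smoothTransition_of_one_lt (show 1 < (i : ℝ) * (1 - ‖y‖ ^ 2) - 1 by
        linarith), mul_zero, neg_zero, abs_zero, zero_mul]
      positivity
    · have h3 := hM ((i : ℝ) * (1 - ‖y‖ ^ 2) - 1)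
      rw [Real.norm_eq_abs] at h3
      have h4 : |c i y| * (1 - ‖y‖ ^ 2) = 2 * ((i : ℝ) * (1 - ‖y‖ ^ 2)) *
          |deriv Real.smoothTransition ((i : ℝ) * (1 - ‖y‖ ^ 2) - 1)| := by
        simp only [hc, abs_neg, abs_mul, Nat.abs_cast, abs_two]
        ring
      rw [h4]
      have h5 : 0 ≤ (i : ℝ) * (1 - ‖y‖ ^ 2) := by positivity
      nlinarith [not_lt.mp h2,
        abs_nonneg (deriv Real.smoothTransition ((i : ℝ) * (1 - ‖y‖ ^ 2) - 1))]
  set K : ℝ := C + L * (4 * M) * ‖paravectorL (n := n) ε‖ with hK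
  have hlim := tendsto_integral_of_dominated_convergence (μ := volume.restrict (ball (0 : Pt n) 1))
    (F := fun i y => rightCauchyRiemann ε (fun y => ballCutoff i y • W y) y * f y)
    (f := fun y => rightCauchyRiemann ε W y * f y) (fun y => K * ‖f y‖)
    (fun i => (continuous_rightCauchyRiemann ε (hWi i)).aestronglyMeasurable.mul hf.memLp.1)
    ((hf.memLp.integrable one_le_two).norm.const_mul K)
    (fun i => by
      filter_upwards [ae_restrict_mem measurableSet_ball] with y hy
      rw [mem_ball_zero_iff] at hy
      refine (norm_mul_le _ _).trans (mul_le_mul_of_nonneg_right ?_ (norm_nonneg _))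
      rw [hD]
      refine (norm_add_le _ _).trans (add_le_add ?_ ?_)
      · rw [norm_smul]
        have h1 : ‖ballCutoff i y‖ ≤ 1 := by
          rw [ballCutoff, Real.norm_of_nonneg (Real.smoothTransition.nonneg _)]
          exact Real.smoothTransition.le_one _
        have h2 := hC y (by simpa using hy.le)
        nlinarith [norm_nonneg (rightCauchyRiemann ε W y)]
      · have h1 : ‖paravector ε (c i y • y)‖ ≤ |c i y| * ‖paravectorL (n := n) ε‖ := by
          rw [paravector_smul, norm_smul, Real.norm_eq_abs, ← paravectorL_apply]
          refine mul_le_mul_of_nonneg_left ?_ (abs_nonneg _)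
          exact ((paravectorL ε).le_opNorm y).trans
            (mul_le_of_le_one_right (norm_nonneg _) hy.le)
        calc ‖W y * paravector ε (c i y • y)‖
            ≤ ‖W y‖ * ‖paravector ε (c i y • y)‖ := norm_mul_le _ _
          _ ≤ (L * (1 - ‖y‖ ^ 2)) * (|c i y| * ‖paravectorL (n := n) ε‖) :=
              mul_le_mul (hL y hy.le) h1 (norm_nonneg _)
                ((norm_nonneg _).trans (hL y hy.le))
          _ = L * (|c i y| * (1 - ‖y‖ ^ 2)) * ‖paravectorL (n := n) ε‖ := by ring
          _ ≤ L * (4 * M) * ‖paravectorL (n := n) ε‖ := by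
              exact mul_le_mul_of_nonneg_right (mul_le_mul_of_nonneg_left (hcb i hy) hL0)
                (norm_nonneg _))
    (by
      filter_upwards [ae_restrict_mem measurableSet_ball] with y hy
      rw [mem_ball_zero_iff] at hy
      refine tendsto_const_nhds.congr' ?_
      filter_upwards [eventually_two_lt_mul hy] with i hi
      have h1 : 1 < (i : ℝ) * (1 - ‖y‖ ^ 2) - 1 := by linarith
      have h2 : ballCutoff i y = 1 := Real.smoothTransition.one_of_one_le h1.le
      rw [hD, h2]
      simp [hc, deriv_smoothTransition_of_one_lt h1, ← paravectorL_apply])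
  simp only [hzero] at hlim
  exact tendsto_nhds_unique hlim tendsto_const_nhds

/-! ### The kernel of the unit ball -/

/-- The function `ρ = 1 - 2⟨y,x⟩ + |y|²|x|²`. -/
noncomputable def ballRho (x y : Pt n) : ℝ := 1 - 2 * inner ℝ y x + ‖y‖ ^ 2 * ‖x‖ ^ 2

theorem hasFDerivAt_ballRho (x y : Pt n) :
    HasFDerivAt (ballRho x) (innerSL ℝ ((-2 : ℝ) • (x - ‖x‖ ^ 2 • y))) y := by
  have h1 : HasFDerivAt (fun y : Pt n => inner ℝ y x) (innerSL ℝ x) y := by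
    have := (innerSL ℝ x).hasFDerivAt (x := y)
    simp only [real_inner_comm x]
    exact this
  refine (((h1.const_mul 2).const_sub 1).add
    ((hasFDerivAt_norm_sq y).mul_const (‖x‖ ^ 2))).congr_fderiv ?_
  ext v
  simp
  ring

theorem contDiff_ballRho {m : WithTop ℕ∞} (x : Pt n) : ContDiff ℝ m (ballRho x) :=
  (contDiff_const.sub (contDiff_const.mul (contDiff_id.inner ℝ contDiff_const))).add
    ((contDiff_norm_sq ℝ).mul contDiff_const)

/-- By Cauchy–Schwarz `ρ ≥ (1 - |x||y|)²`. The bound is uniform in `y`, so the kernel is not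
singular on the closed ball for fixed `x`. -/
theorem sq_one_sub_le_ballRho {x y : Pt n} (hx : ‖x‖ ≤ 1) (hy : ‖y‖ ≤ 1) :
    (1 - ‖x‖) ^ 2 ≤ ballRho x y := by
  have h := real_inner_le_norm y x
  have h1 : (1 - ‖y‖ * ‖x‖) ^ 2 ≤ ballRho x y := by
    rw [ballRho]
    nlinarith
  refine le_trans (pow_le_pow_left₀ (by linarith) ?_ 2) h1
  nlinarith [norm_nonneg x]

theorem ballRho_pos {x y : Pt n} (hx : ‖x‖ < 1) (hy : ‖y‖ ≤ 1) : 0 < ballRho x y :=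
  (pow_pos (sub_pos.mpr hx) 2).trans_le (sq_one_sub_le_ballRho hx.le hy)

/-- The Bergman kernel of the unit ball, up to the constant `sphereArea n`. -/
noncomputable def ballForm (ε : ℝ) (x y : Pt n) : Cl n :=
  (((n : ℝ) + 1) * ballRho x y ^ (-(((n : ℝ) + 1) / 2))) • (1 : Cl n)
    - (2 * ballRho x y ^ (-(((n : ℝ) + 1) / 2))) • (star (paravector ε x) * paravector ε y)
    + (((n : ℝ) + 1) * ballRho x y ^ (-(((n : ℝ) + 1) / 2) - 1)) •
      (star (paravector ε (y - ‖y‖ ^ 2 • x)) * paravector ε (x - ‖x‖ ^ 2 • y))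

theorem ballKernel_eq {ε lam : ℝ} {x y : Pt n} (hx : ‖x‖ < 1) (hy : ‖y‖ ≤ 1) :
    ballKernel ε lam x y =
      (Real.exp ((x 0 - y 0) * lam) / sphereArea n) • ballForm ε x y := by
  have hρ := ballRho_pos hx hy
  have h1 : ballRho x y ^ (((n : ℝ) + 1 + 2) / 2) =
      (ballRho x y ^ (-(((n : ℝ) + 1) / 2) - 1))⁻¹ := by
    rw [← Real.rpow_neg hρ.le]
    congr 1
    ring
  have h2 : ballRho x y ^ (((n : ℝ) + 1) / 2) = (ballRho x y ^ (-(((n : ℝ) + 1) / 2)))⁻¹ := by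
    rw [← Real.rpow_neg hρ.le, neg_neg]
  have hρ' : 1 - 2 * inner ℝ y x + ‖y‖ ^ 2 * ‖x‖ ^ 2 = ballRho x y := rfl
  have hG := Real.Gamma_pos_of_pos (show (0 : ℝ) < ((n : ℝ) + 1) / 2 by positivity)
  simp only [ballKernel, ballForm, hρ', h1, h2, div_inv_eq_mul, paravector_sub, paravector_smul,
    Algebra.algebraMap_eq_smul_one, sphereArea_eq]
  congr 1
  field_simp

theorem pderiv_star_paravector_sub {ε : ℝ} {k : Fin (n + 1)} (x y : Pt n) :
    pderiv k (fun y => star (paravector ε (y - ‖y‖ ^ 2 • x))) y =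
      star (dir ε k) - (2 * y k) • star (paravector ε x) := by
  have h1 : (fun y : Pt n => star (paravector ε (y - ‖y‖ ^ 2 • x))) =
      fun y => star (paravector ε y) - ‖y‖ ^ 2 • star (paravector ε x) := by
    ext y
    rw [paravector_sub, paravector_smul, star_sub, star_real_smul]
  have h2 := (hasFDerivAt_star_paravector ε y).fun_sub
    ((hasFDerivAt_norm_sq y).smul_const (star (paravector ε x)))
  rw [h1, pderiv, h2.fderiv]
  simp [paravectorL_apply, paravector_single, EuclideanSpace.inner_single_right]

theorem hasFDerivAt_const_mul_ballRho_rpow (c a : ℝ) {x y : Pt n} (hρ : 0 < ballRho x y) :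
    HasFDerivAt (fun y => c * ballRho x y ^ a)
      (innerSL ℝ ((-(2 * c * a * ballRho x y ^ (a - 1))) • (x - ‖x‖ ^ 2 • y))) y := by
  have h1 := hasFDerivAt_comp_innerSL (P := fun s => c * s ^ a)
    ((Real.hasDerivAt_rpow_const (p := a) (Or.inl hρ.ne')).const_mul c) (hasFDerivAt_ballRho x y)
  have h2 : (-(2 * c * a * ballRho x y ^ (a - 1))) • (x - ‖x‖ ^ 2 • y) =
      (c * (a * ballRho x y ^ (a - 1))) • (-2 : ℝ) • (x - ‖x‖ ^ 2 • y) := by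
    rw [smul_smul]
    congr 1
    ring
  rw [h2]
  exact h1

theorem contDiff_star_paravector_sub {ε : ℝ} {m : WithTop ℕ∞} (x : Pt n) :
    ContDiff ℝ m (fun y => star (paravector ε (y - ‖y‖ ^ 2 • x))) :=
  contDiff_star.comp (contDiff_paravector.comp
    (contDiff_id.sub ((contDiff_norm_sq ℝ).smul contDiff_const)))

theorem rightCauchyRiemann_star_paravector_sub {ε : ℝ} (hε : ε * ε = 1) (x y : Pt n) :
    rightCauchyRiemann ε (fun y => star (paravector ε (y - ‖y‖ ^ 2 • x))) y =
      ((n : ℝ) + 1) • 1 - (2 : ℝ) • (star (paravector ε x) * paravector ε y) := by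
  simp only [rightCauchyRiemann, pderiv_star_paravector_sub, sub_mul, Finset.sum_sub_distrib,
    sum_star_dir_mul_dir hε]
  rw [paravector_eq_sum ε y, Finset.mul_sum, Finset.smul_sum]
  simp only [mul_smul_comm, smul_mul_assoc, smul_smul]

/-- `W` is the difference of the reflected potential and the smoothed Cauchy kernel at `x`; it plays
the role of a Green potential with zero boundary values. -/
theorem exists_ballPotential {ε : ℝ} (hε : ε * ε = 1) {x : Pt n} {t : ℝ} (ht : 0 < t)
    (hxt : t < 1 - ‖x‖) :
    ∃ W : Pt n → Cl n, ContDiff ℝ 1 W ∧ (∀ y, ‖y‖ = 1 → W y = 0) ∧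
      ∀ y, ‖y‖ ≤ 1 → rightCauchyRiemann ε W y = ballForm ε x y - meanKernel t (y - x) • 1 := by
  have hx : ‖x‖ < 1 := by linarith
  set m : ℝ := (n : ℝ) + 1 with hm
  have hp : ContDiff ℝ 1 (smoothPow m t) := (contDiff_smoothPow m t).of_le (by simp)
  set U : Pt n → Cl n := fun y =>
    smoothPow m t (ballRho x y) • star (paravector ε (y - ‖y‖ ^ 2 • x)) with hU
  set E : Pt n → Cl n := fun y =>
    smoothPow m t (‖y - x‖ ^ 2) • star (paravector ε (y - x)) with hE
  have hUd : ContDiff ℝ 1 U :=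
    (hp.comp (contDiff_ballRho x)).fun_smul (contDiff_star_paravector_sub x)
  have hEd : ContDiff ℝ 1 E :=
    (hp.comp ((contDiff_norm_sq ℝ).comp (contDiff_id.sub contDiff_const))).fun_smul
      (contDiff_star.comp (contDiff_paravector.comp (contDiff_id.sub contDiff_const)))
  refine ⟨fun y => U y - E y, hUd.sub hEd, fun y hy => ?_, fun y hy => ?_⟩
  · have h1 : ballRho x y = ‖y - x‖ ^ 2 := by
      rw [ballRho, norm_sub_sq_real, hy]
      ring
    simp [hU, hE, h1, hy]
  · have hsub : rightCauchyRiemann ε (fun y => U y - E y) y =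
        rightCauchyRiemann ε U y - rightCauchyRiemann ε E y := by
      simp [rightCauchyRiemann, pderiv, fderiv_fun_sub (hUd.differentiable one_ne_zero y)
        (hEd.differentiable one_ne_zero y), sub_mul]
    -- Here `t < 1 - ‖x‖` is used: at `ρ` the smoothed power is the exact power throughout the
    -- closed ball.
    have hρt : t ^ 2 < ballRho x y :=
      (pow_lt_pow_left₀ hxt ht.le two_ne_zero).trans_le (sq_one_sub_le_ballRho hx.le hy)
    have hUD : rightCauchyRiemann ε U y = ballForm ε x y := by
      rw [hU, rightCauchyRiemann_smul ε (hasFDerivAt_comp_innerSL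
        (differentiable_smoothPow m t _).hasDerivAt (hasFDerivAt_ballRho x y))
        ((contDiff_star_paravector_sub (m := 1) x).differentiable one_ne_zero y),
        rightCauchyRiemann_star_paravector_sub hε, smoothPow_of_le ht hρt.le,
        deriv_smoothPow_of_lt ht hρt, ballForm, smul_smul, paravector_smul, mul_smul_comm,
        ← hm]
      module
    have hED : rightCauchyRiemann ε E y = meanKernel t (y - x) • 1 :=
      rightCauchyRiemann_radial hε x y (differentiable_smoothPow m t _)
    rw [hsub, hUD, hED]

/-! ### Monogenicity of the ball kernel in its second variable. -/

theorem star_ballForm (ε : ℝ) (x y : Pt n) : star (ballForm ε x y) =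
    (((n : ℝ) + 1) * ballRho x y ^ (-(((n : ℝ) + 1) / 2))) • (1 : Cl n)
    - (2 * ballRho x y ^ (-(((n : ℝ) + 1) / 2))) • (star (paravector ε y) * paravector ε x)
    + (((n : ℝ) + 1) * ballRho x y ^ (-(((n : ℝ) + 1) / 2) - 1)) •
      (star (paravector ε (x - ‖x‖ ^ 2 • y)) * paravector ε (y - ‖y‖ ^ 2 • x)) := by
  simp [ballForm]

theorem contDiffAt_ballRho_rpow {a : ℝ} {x y : Pt n} (hρ : 0 < ballRho x y) :
    ContDiffAt ℝ 1 (fun y => ballRho x y ^ a) y :=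
  (contDiff_ballRho x).contDiffAt.rpow_const_of_ne hρ.ne'

theorem contDiff_paravector_sub {ε : ℝ} {m : WithTop ℕ∞} (x : Pt n) :
    ContDiff ℝ m (fun y => paravector ε (y - ‖y‖ ^ 2 • x)) :=
  contDiff_paravector.comp (contDiff_id.sub ((contDiff_norm_sq ℝ).smul contDiff_const))

theorem contDiff_star_paravector_const_sub {ε : ℝ} {m : WithTop ℕ∞} (x : Pt n) :
    ContDiff ℝ m (fun y => star (paravector ε (x - ‖x‖ ^ 2 • y))) :=
  contDiff_star.comp (contDiff_paravector.comp
    (contDiff_const.sub (contDiff_id.const_smul (‖x‖ ^ 2))))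

theorem contDiffAt_star_ballForm {ε : ℝ} {x y : Pt n} (hρ : 0 < ballRho x y) :
    ContDiffAt ℝ 1 (fun y => star (ballForm ε x y)) y := by
  simp only [star_ballForm]
  refine (((contDiffAt_const.mul (contDiffAt_ballRho_rpow hρ)).smul contDiffAt_const).sub
    ((contDiffAt_const.mul (contDiffAt_ballRho_rpow hρ)).smul
      ((contDiff_star.comp contDiff_paravector).contDiffAt.mul contDiffAt_const))).add
    ((contDiffAt_const.mul (contDiffAt_ballRho_rpow hρ)).smul
      ((contDiff_star_paravector_const_sub x).mul (contDiff_paravector_sub x)).contDiffAt)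

theorem cauchyRiemann_star_paravector_mul {ε : ℝ} (hε : ε * ε = 1) (a : Cl n) (y : Pt n) :
    cauchyRiemann ε (fun y => star (paravector ε y) * a) y = ((n : ℝ) + 1) • a := by
  have h (k : Fin (n + 1)) :
      pderiv k (fun y : Pt n => star (paravector ε y) * a) y = star (dir ε k) * a := by
    rw [pderiv_mul_const a (hasFDerivAt_star_paravector ε y).differentiableAt, pderiv,
      (hasFDerivAt_star_paravector ε y).fderiv]
    simp [paravectorL_apply, paravector_single]
  simp only [cauchyRiemann_eq_sum, h, ← mul_assoc]
  rw [← Finset.sum_mul, sum_dir_mul_star_dir hε, smul_one_mul]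

/-- With `dₖ = dir ε k`, `dₖ v̄ = 2vₖ - v d̄ₖ`, so the sum is `2v - (n+1)v`. -/
theorem sum_dir_mul_star_mul_dir {ε : ℝ} (hε : ε * ε = 1) (v : Pt n) :
    ∑ k, dir ε k * star (paravector ε v) * dir ε k = (1 - (n : ℝ)) • paravector ε v := by
  have h (k : Fin (n + 1)) : dir ε k * star (paravector ε v) * dir ε k =
      (2 : ℝ) • v k • dir ε k - paravector ε v * (star (dir ε k) * dir ε k) := by
    have h1 := paravector_mul_star_add hε (EuclideanSpace.single k 1) v
    rw [paravector_single, EuclideanSpace.inner_single_left] at h1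
    rw [eq_sub_of_add_eq h1, sub_mul, smul_one_mul, mul_assoc, smul_smul]
    simp
  simp only [h, Finset.sum_sub_distrib]
  rw [← Finset.smul_sum, ← Finset.mul_sum, sum_star_dir_mul_dir hε, ← paravector_eq_sum,
    mul_smul_comm, mul_one]
  module

theorem cauchyRiemann_star_paravector_mul_paravector {ε : ℝ} (hε : ε * ε = 1) (x y : Pt n) :
    cauchyRiemann ε
      (fun y => star (paravector ε (x - ‖x‖ ^ 2 • y)) * paravector ε (y - ‖y‖ ^ 2 • x)) y =
      (1 - (n : ℝ)) • paravector ε (x - ‖x‖ ^ 2 • y)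
      - (2 : ℝ) • (paravector ε y * star (paravector ε (x - ‖x‖ ^ 2 • y)) * paravector ε x)
      - (((n : ℝ) + 1) * ‖x‖ ^ 2) • paravector ε (y - ‖y‖ ^ 2 • x) := by
  have h1 (k : Fin (n + 1)) : pderiv k (fun y => star (paravector ε (x - ‖x‖ ^ 2 • y))) y =
      -(‖x‖ ^ 2 • star (dir ε k)) := by
    have h : (fun y : Pt n => star (paravector ε (x - ‖x‖ ^ 2 • y))) =
        fun y => star (paravector ε x) - ‖x‖ ^ 2 • star (paravector ε y) := by
      ext y
      rw [paravector_sub, paravector_smul, star_sub, star_real_smul]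
    rw [h, pderiv, (((hasFDerivAt_star_paravector ε y).fun_const_smul (‖x‖ ^ 2)).const_sub _).fderiv]
    simp [paravectorL_apply, paravector_single]
  have h2 (k : Fin (n + 1)) : pderiv k (fun y => paravector ε (y - ‖y‖ ^ 2 • x)) y =
      dir ε k - (2 * y k) • paravector ε x := by
    have h : (fun y : Pt n => paravector ε (y - ‖y‖ ^ 2 • x)) =
        fun y => paravector ε y - ‖y‖ ^ 2 • paravector ε x := by
      ext y
      rw [paravector_sub, paravector_smul]
    rw [h, pderiv, ((hasFDerivAt_paravector ε y).fun_sub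
      ((hasFDerivAt_norm_sq y).smul_const (paravector ε x))).fderiv]
    simp [paravectorL_apply, paravector_single, EuclideanSpace.inner_single_right]
  simp only [cauchyRiemann_eq_sum, pderiv_mul
    ((contDiff_star_paravector_const_sub (m := 1) x).differentiable one_ne_zero y)
    ((contDiff_paravector_sub (m := 1) x).differentiable one_ne_zero y), h1, h2, mul_add, mul_sub,
    Finset.sum_add_distrib, Finset.sum_sub_distrib, ← mul_assoc, sum_dir_mul_star_mul_dir hε]
  have h3 : ∑ k, dir ε k * star (paravector ε (x - ‖x‖ ^ 2 • y)) * (2 * y k) • paravector ε x =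
      (2 : ℝ) • (paravector ε y * star (paravector ε (x - ‖x‖ ^ 2 • y)) * paravector ε x) := by
    rw [paravector_eq_sum ε y, Finset.sum_mul, Finset.sum_mul, Finset.smul_sum]
    simp only [mul_smul_comm, smul_mul_assoc, smul_smul]
  have h4 : ∑ k, dir ε k * -(‖x‖ ^ 2 • star (dir ε k)) * paravector ε (y - ‖y‖ ^ 2 • x) =
      -((((n : ℝ) + 1) * ‖x‖ ^ 2) • paravector ε (y - ‖y‖ ^ 2 • x)) := by
    simp only [mul_neg, mul_smul_comm, neg_mul, Finset.sum_neg_distrib, smul_mul_assoc]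
    rw [← Finset.smul_sum, ← Finset.sum_mul, sum_dir_mul_star_dir hε, smul_one_mul, smul_smul,
      mul_comm]
  rw [h3, h4, sub_eq_add_neg _ ((((n : ℝ) + 1) * ‖x‖ ^ 2) • _)]

theorem norm_sub_smul_sq (x y : Pt n) : ‖x - ‖x‖ ^ 2 • y‖ ^ 2 = ‖x‖ ^ 2 * ballRho x y := by
  rw [norm_sub_sq_real, norm_smul, real_inner_smul_right, mul_pow, norm_pow, norm_norm, ballRho,
    real_inner_comm]
  ring

/-- Put `V = x - |x|²y`. After `VV̄ = |x|²ρ` and an exchange of the factors in `V ȳ x`, the triple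
products `y V̄ x` cancel; what is left is a scalar multiple of `x` whose coefficient vanishes by the
definition of `ρ`. -/
theorem cauchyRiemann_star_ballForm {ε : ℝ} (hε : ε * ε = 1) {x y : Pt n}
    (hρ : 0 < ballRho x y) : cauchyRiemann ε (fun y => star (ballForm ε x y)) y = 0 := by
  set m : ℝ := (n : ℝ) + 1 with hm
  set a : ℝ := -(m / 2) with ha
  set F1 : Pt n → Cl n := fun y => (m * ballRho x y ^ a) • (1 : Cl n) with hF1
  set F2 : Pt n → Cl n := fun y =>
    (2 * ballRho x y ^ a) • (star (paravector ε y) * paravector ε x) with hF2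
  set F3 : Pt n → Cl n := fun y => (m * ballRho x y ^ (a - 1)) •
    (star (paravector ε (x - ‖x‖ ^ 2 • y)) * paravector ε (y - ‖y‖ ^ 2 • x)) with hF3
  have d1 : DifferentiableAt ℝ (fun y => star (paravector ε y) * paravector ε x) y :=
    (hasFDerivAt_star_paravector ε y).differentiableAt.mul_const _
  have d2 : DifferentiableAt ℝ (fun y => star (paravector ε (x - ‖x‖ ^ 2 • y)) *
      paravector ε (y - ‖y‖ ^ 2 • x)) y :=
    ((contDiff_star_paravector_const_sub (m := 1) x).differentiable one_ne_zero y).mul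
      ((contDiff_paravector_sub (m := 1) x).differentiable one_ne_zero y)
  have hu (c b : ℝ) := hasFDerivAt_const_mul_ballRho_rpow c b hρ
  have e1 := cauchyRiemann_smul ε (hu m a) (differentiableAt_const (1 : Cl n))
  have e2 := cauchyRiemann_smul ε (hu 2 a) d1
  have e3 := cauchyRiemann_smul ε (hu m (a - 1)) d2
  have D1 : DifferentiableAt ℝ F1 y := (hu m a).differentiableAt.fun_smul (differentiableAt_const _)
  have D2 : DifferentiableAt ℝ F2 y := (hu 2 a).differentiableAt.fun_smul d1
  have D3 : DifferentiableAt ℝ F3 y := (hu m (a - 1)).differentiableAt.fun_smul d2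
  have hsum : cauchyRiemann ε (fun y => star (ballForm ε x y)) y =
      cauchyRiemann ε F1 y - cauchyRiemann ε F2 y + cauchyRiemann ε F3 y := by
    have : (fun y => star (ballForm ε x y)) = fun y => F1 y - F2 y + F3 y :=
      funext fun y => star_ballForm ε x y
    simp [this, cauchyRiemann_eq_sum, pderiv, fderiv_fun_add (D1.fun_sub D2) D3,
      fderiv_fun_sub D1 D2, mul_add, mul_sub, Finset.sum_add_distrib]
  have hc : cauchyRiemann ε (fun _ : Pt n => (1 : Cl n)) y = 0 := by
    simp [cauchyRiemann_eq_sum, pderiv]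
  rw [hsum, e1, e2, e3, hc, cauchyRiemann_star_paravector_mul hε,
    cauchyRiemann_star_paravector_mul_paravector hε]
  simp only [paravector_smul ε (-_), smul_mul_assoc]
  have hVV := paravector_mul_star_self hε (x - ‖x‖ ^ 2 • y)
  have hVY := paravector_mul_star_add hε (x - ‖x‖ ^ 2 • y) y
  rw [norm_sub_smul_sq] at hVV
  rw [inner_sub_left, real_inner_smul_left, real_inner_self_eq_norm_sq, real_inner_comm] at hVY
  have hVYX : paravector ε (x - ‖x‖ ^ 2 • y) * (star (paravector ε y) * paravector ε x) =
      (2 * (inner ℝ y x - ‖x‖ ^ 2 * ‖y‖ ^ 2)) • paravector ε x -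
        paravector ε y * star (paravector ε (x - ‖x‖ ^ 2 • y)) * paravector ε x := by
    rw [← mul_assoc, eq_sub_of_add_eq hVY, sub_mul, smul_one_mul]
  have hVVW : paravector ε (x - ‖x‖ ^ 2 • y) * (star (paravector ε (x - ‖x‖ ^ 2 • y)) *
      paravector ε (y - ‖y‖ ^ 2 • x)) =
      (‖x‖ ^ 2 * ballRho x y) • paravector ε (y - ‖y‖ ^ 2 • x) := by
    rw [← mul_assoc, hVV, smul_one_mul]
  rw [hVYX, hVVW]
  set Z := paravector ε y * star (paravector ε (x - ‖x‖ ^ 2 • y)) * paravector ε x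
  -- All powers of `ρ` are expressed through the lowest one, `ρ^{a-2}`, so that the remaining
  -- identity is polynomial in `ρ`.
  have hq : ballRho x y ^ a = ballRho x y * ballRho x y ^ (a - 1) := by
    rw [Real.rpow_sub_one hρ.ne']
    field_simp
  have hr : ballRho x y ^ (a - 1) = ballRho x y * ballRho x y ^ (a - 1 - 1) := by
    rw [Real.rpow_sub_one hρ.ne' (a - 1)]
    field_simp
  set r := ballRho x y ^ (a - 1 - 1) with hrdef
  rw [hq, hr]
  simp only [paravector_sub, paravector_smul, mul_one, smul_zero, zero_add, ha, hm]
  have hρ' : ballRho x y = 1 - 2 * inner ℝ y x + ‖y‖ ^ 2 * ‖x‖ ^ 2 := rfl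
  set N : ℝ := (n : ℝ)
  rw [hρ']
  module

/-- The Bergman kernel of the unit ball. -/
theorem isBergmanKernel_ballForm {ε : ℝ} (hε : ε * ε = 1) :
    IsBergmanKernel ε (ball (0 : Pt n) 1) (fun x y => (sphereArea n)⁻¹ • ballForm ε x y) := by
  have hmem {x : Pt n} (hx : ‖x‖ < 1) :
      MemBergmanSpace ε (ball (0 : Pt n) 1) (fun y => star (ballForm ε x y)) := by
    have hfin : IsFiniteMeasure (volume.restrict (ball (0 : Pt n) 1)) :=
      ⟨by rw [Measure.restrict_apply_univ]; exact measure_ball_lt_top⟩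
    have hcont : ContinuousOn (fun y => star (ballForm ε x y)) (closedBall 0 1) := fun y hy =>
      (contDiffAt_star_ballForm (ballRho_pos hx
        (mem_closedBall_zero_iff.mp hy))).continuousAt.continuousWithinAt
    obtain ⟨C, hC⟩ := (isCompact_closedBall (0 : Pt n) 1).exists_bound_of_continuousOn hcont
    refine ⟨fun y hy => ?_, fun y hy => ?_, ?_⟩
    · exact (contDiffAt_star_ballForm (ballRho_pos hx
        (mem_ball_zero_iff.mp hy).le)).contDiffWithinAt
    · exact cauchyRiemann_star_ballForm hε (ballRho_pos hx (mem_ball_zero_iff.mp hy).le)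
    · refine MemLp.of_bound ((hcont.mono ball_subset_closedBall).aestronglyMeasurable
        measurableSet_ball) C ?_
      filter_upwards [ae_restrict_mem measurableSet_ball] with y hy
      exact hC y (ball_subset_closedBall hy)
  refine ⟨fun x hx => ?_, fun f hf x hx => ?_⟩
  · simp only [star_real_smul]
    exact (hmem (mem_ball_zero_iff.mp hx)).const_smul isOpen_ball _
  · have hx1 := mem_ball_zero_iff.mp hx
    -- Any `t` strictly between `0` and `1 - ‖x‖` serves: the mean value ball lies in the unit ball
    -- and the potential exists.
    set t : ℝ := (1 - ‖x‖) / 2 with htdef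
    have ht : 0 < t := by rw [htdef]; linarith
    have hball : closedBall x t ⊆ ball 0 1 := fun y hy => by
      rw [mem_ball_zero_iff]
      have h1 := norm_le_norm_add_norm_sub x y
      rw [mem_closedBall, dist_eq_norm] at hy
      rw [htdef] at hy
      linarith [norm_sub_rev x y]
    obtain ⟨W, hW, hW0, hDW⟩ := exists_ballPotential hε ht (show t < 1 - ‖x‖ by
      rw [htdef]; linarith)
    have h0 := integral_ball_rightCauchyRiemann_mul_eq_zero hW hW0 hf
    have h1 : ∫ y in ball 0 1, rightCauchyRiemann ε W y * f y =
        ∫ y in ball 0 1, (ballForm ε x y * f y - meanKernel t (y - x) • f y) := by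
      refine setIntegral_congr_fun measurableSet_ball fun y hy => ?_
      simp only [hDW y (mem_ball_zero_iff.mp hy).le, sub_mul, smul_one_mul]
    have i1 := (hmem hx1).integrable_star_mul hf
    simp only [star_star] at i1
    rw [h1, integral_sub i1
      (integrable_meanKernel_smul isOpen_ball hf.contDiffOn ht hball).integrableOn, sub_eq_zero] at h0
    simp only [smul_mul_assoc]
    rw [integral_smul, h0]
    exact (setIntegral_meanKernel_smul hε isOpen_ball hf ht hball).symm

theorem exp_smul_algebraMap (lam r : ℝ) :
    NormedSpace.exp (r • algebraMap ℝ (Cl n) lam) = algebraMap ℝ (Cl n) (Real.exp (r * lam)) := by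
  rw [Real.exp_eq_exp_ℝ, NormedSpace.algebraMap_exp_comm]
  congr 1
  rw [map_mul, Algebra.smul_def]

end CliffordBergman

/-! ### Assembly of the theorem. -/

theorem mainTheorem8 (n : ℕ) (ε : ℝ) (hε : ε = 1 ∨ ε = -1) :
    -- existence and uniqueness of the Bergman kernel, and the reproducing formulas
    (∀ Ω : Set (CliffordBergman.Pt n), IsOpen Ω →
      CliffordBergman.IsBergmanKernel ε Ω (CliffordBergman.bergmanKernel ε Ω) ∧
      (∀ B, CliffordBergman.IsBergmanKernel ε Ω B →
        ∀ x ∈ Ω, ∀ y ∈ Ω, B x y = CliffordBergman.bergmanKernel ε Ω x y) ∧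
      (∀ (lam : CliffordBergman.Cl n) (f : CliffordBergman.Pt n → CliffordBergman.Cl n),
        CliffordBergman.IsLambdaMonogenic ε lam Ω f →
        (Bornology.IsBounded Ω ∨
          MemLp (fun y => f y * NormedSpace.exp ((-y 0) • lam)) 2 (volume.restrict Ω)) →
        ∀ x ∈ Ω,
          IntegrableOn (fun y => CliffordBergman.bergmanKernel ε Ω x y *
            (f y * NormedSpace.exp ((x 0 - y 0) • lam))) Ω ∧
          ∫ y in Ω, CliffordBergman.bergmanKernel ε Ω x y *
            (f y * NormedSpace.exp ((x 0 - y 0) • lam)) = f x) ∧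
      (∀ (lam : ℝ) (f : CliffordBergman.Pt n → CliffordBergman.Cl n),
        CliffordBergman.IsLambdaMonogenic ε (algebraMap ℝ (CliffordBergman.Cl n) lam) Ω f →
        (Bornology.IsBounded Ω ∨
          MemLp (fun y => f y * NormedSpace.exp
            ((-y 0) • algebraMap ℝ (CliffordBergman.Cl n) lam)) 2 (volume.restrict Ω)) →
        ∀ x ∈ Ω,
          IntegrableOn (fun y => CliffordBergman.lambdaKernel ε Ω
            (algebraMap ℝ (CliffordBergman.Cl n) lam) x y * f y) Ω ∧
          ∫ y in Ω, CliffordBergman.lambdaKernel ε Ω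
            (algebraMap ℝ (CliffordBergman.Cl n) lam) x y * f y = f x)) ∧
    -- the explicit formula on the unit ball
    (∀ (lam : ℝ), ∀ x ∈ Metric.ball (0 : CliffordBergman.Pt n) 1,
      ∀ y ∈ Metric.ball (0 : CliffordBergman.Pt n) 1,
        CliffordBergman.lambdaKernel ε (Metric.ball 0 1)
            (algebraMap ℝ (CliffordBergman.Cl n) lam) x y =
          CliffordBergman.ballKernel ε lam x y) := by
  have hε2 : ε * ε = 1 := by rcases hε with rfl | rfl <;> norm_num
  refine ⟨fun Ω hΩ => ?_, fun lam x hx y hy => ?_⟩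
  · have hB := CliffordBergman.isBergmanKernel_bergmanKernel hε2 hΩ
    refine ⟨hB, fun B hB' x hx y hy => hB'.unique hΩ hB hx hy,
      fun lam f hf hL x hx => hB.lambda_reproducing hΩ hf hL hx, fun lam f hf hL x hx => ?_⟩
    have h := hB.lambda_reproducing hΩ hf hL hx
    -- For real `lam` the exponential is a real scalar, so it commutes past `f y`.
    have heq (y : CliffordBergman.Pt n) : CliffordBergman.lambdaKernel ε Ω
        (algebraMap ℝ (CliffordBergman.Cl n) lam) x y * f y =
        CliffordBergman.bergmanKernel ε Ω x y * (f y * NormedSpace.exp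
          ((x 0 - y 0) • algebraMap ℝ (CliffordBergman.Cl n) lam)) := by
      rw [CliffordBergman.lambdaKernel, CliffordBergman.exp_smul_algebraMap, mul_assoc,
        Algebra.commutes]
    simpa only [heq] using h
  · have hK := CliffordBergman.isBergmanKernel_ballForm (n := n) hε2
    have hB := CliffordBergman.isBergmanKernel_bergmanKernel (n := n) hε2
      (Metric.isOpen_ball (x := 0) (ε := 1))
    rw [CliffordBergman.lambdaKernel, CliffordBergman.exp_smul_algebraMap,
      hB.unique Metric.isOpen_ball hK hx hy,
      CliffordBergman.ballKernel_eq (mem_ball_zero_iff.mp hx) (mem_ball_zero_iff.mp hy).le,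
      ← Algebra.commutes, ← Algebra.smul_def, smul_smul, div_eq_mul_inv]
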